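/- **Setting.** For each sample size $n$ let the complete data be $X=(X_{\rm obs},X_{\rm mis})$ with sampling density $f(X\mid\psi)$, $\psi\in\Psi$, where $\Psi\subseteq\mathbb R^h$ is open and $h\ge 1$; the density is jointly measurable in $(\psi,X)$ and is taken with respect to a reference measure $\rho_n(dx_{\rm obs})\,\lambda_n(x_{\rm obs},dx_{\rm mis})$. Let $\psi^\star\in\Psi$ be the true value and $m>1$. Given $X_{\rm obs}$, the imputations $X^1_{\rm mis},\dots,X^m_{\rm mis}$ are drawn independently from an imputation model; put $X^\ell=(X_{\rm obs},X^\ell_{\rm mis})$, $\ell=1,\dots,m$. Write $L^\ell(\psi)=\log f(X^\ell\mid\psi)$, $\overline L(\psi^1,\dots,\psi^m)=m^{-1}\sum_\ell L^\ell(\psi^\ell)$ and $\overline L(\psi)=\overline L(\psi,\dots,\psi)$. Let $\widehat\psi(X)$ be the complete-data MLE, $\widehat\psi^\ell=\widehat\psi(X^\ell)$, $\widehat\psi_{\rm obs}$ the observed-data MLE (a maximizer of $\psi\mapsto\int f(X_{\rm obs},y\mid\psi)\,\lambda_n(X_{\rm obs},dy)$), and $\widehat\psi^*$ a maximizer of $\overline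 L(\psi)$ over $\Psi$, all measurable. Let $I(\psi\mid X)=-\partial^2\log f(X\mid\psi)/\partial\psi\,\partial\psi^{\mathsf T}$. **Conditions $\mathrm{RC}_\psi$ (at $\psi^\star$).** There are a positive definite matrix $\mathcal I$, matrices $\mathcal T_n$ and a number $r>0$ such that, with $\mathcal U_n=(n\mathcal I)^{-1}$ and $\mathcal B_n=\mathcal T_n-\mathcal U_n$: 1. for all large $n$, almost surely, both for $X$ and for each completed data set $X^\ell$ in place of $X$: $f(X\mid\psi)>0$ for all $\psi\in\Psi$, $\psi\mapsto\log f(X\mid\psi)$ is $C^2$ on $\Psi$, and $\widehat\psi(X)$ maximizes it over $\Psi$ and is the unique root of the score in $\Psi$; the maximizers $\widehat\psi_{\rm obs}$ and $\widehat\psi^*$ exist in $\Psi$; 2. $n^{-1}I(\psi^\star\mid X)\to\mathcal I$ in probability; 3. $\mathcal T_n^{-1/2}(\widehat\psi_{\rm obs}-\psi^\star)\Rightarrow N_h(0,I_h)$; 4. the conditional law of $\mathcal B_n^{-1/2}(\widehat\psi^\ell-\widehat\psi_{\rm obs})$ given $X_{\rm obs}$ converges weakly, in probability, to $N_h(0,I_h)$;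 5. (lower-order variability) $\mathcal T_n^{-1}\{I(\psi\mid X^\ell)^{-1}-\mathcal U_n\}\to0$ in probability, asymptotically uniformly near $\psi^\star$: for every $\varepsilon>0$ there is $\delta>0$ such that the probability that some entry is at least $\varepsilon$ in absolute value for some $\psi\in\Psi$ with $\|\psi-\psi^\star\|<\delta$ tends to $0$; 6. (well-separated maximum) for every $\varepsilon>0$ there is $\delta>0$ such that, with probability tending to $1$, $n^{-1}L^\ell(\psi)\le n^{-1}L^\ell(\psi^\star)-\delta$ for all $\psi\in\Psi$ with $\|\psi-\psi^\star\|\ge\varepsilon$; 7. (equal fraction of missing information) $\mathcal T_n=(1+r)\,\mathcal U_n$ for all $n\ge1$. Let $r_m=(1+1/m)\,r$ and $$\widehat r^{\rm rob}=\frac{m+1}{h(m-1)}\bigl\{2\overline L(\widehat\psi^1,\dots,\widehat\psi^m)-2\overline L(\widehat\psi^*,\dots,\widehat\psi^*)\bigr\}.$$ Let also $k\ge1$, let $\theta:\Psi\to\mathbb R^k$ be $C^1$ with surjective derivative at $\psi^\star$, let $\theta_0\in\mathbb R^k$, and consider $H_0:\theta(\psi^\star)=\theta_0$. **Theorem.**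 Assume $\mathrm{RC}_\psi$ and $m>1$. There are independent random variables $M_1\sim\chi^2_k/k$ and $M_3\sim\chi^2_{h(m-1)}/\{h(m-1)\}$ such that, for any true value $\psi^\star\in\Psi$ (whether or not $H_0$ holds), $$\frac{\widehat r^{\rm rob}}{r_m}\Rightarrow M_3\qquad(n\to\infty).$$ Moreover, $M_3$ is independent of the limit $M_1$ of the LRT numerator: if $H_0$ holds and $\widehat\psi_0^*$ is a (measurable) maximizer of $\overline L(\psi)$ over $\{\psi\in\Psi:\theta(\psi)=\theta_0\}$ (almost surely, for all large $n$), and $\widehat d=2\{\overline L(\widehat\psi^*)-\overline L(\widehat\psi_0^*)\}$, then jointly $$\Bigl(\frac{\widehat r^{\rm rob}}{r_m},\ \frac{\widehat d}{k(1+r_m)}\Bigr)\Rightarrow(M_3,M_1)\qquad(n\to\infty).$$ -/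

import Mathlib

open MeasureTheory ProbabilityTheory Filter Topology
open scoped ENNReal BoundedContinuousFunction MatrixOrder

noncomputable section

/-- The law of `χ²_ν / ν`, where `χ²_ν` is the sum of squares of `ν` independent standard normal
variables. -/
def chiSquaredOver (ν : ℕ) : Measure ℝ :=
  (Measure.pi (fun _ : Fin ν => gaussianReal 0 1)).map (fun z => (∑ i, z i ^ 2) / (ν : ℝ))

/-- `A v`, for a square matrix `A` and a vector `v` of Euclidean space. -/
def matVec {h : ℕ} (A : Matrix (Fin h) (Fin h) ℝ) (v : EuclideanSpace ℝ (Fin h)) :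
    EuclideanSpace ℝ (Fin h) :=
  Matrix.toEuclideanCLM (𝕜 := ℝ) A v

/-- `A ^ (-1/2)`: the positive semidefinite square root of the inverse of a positive definite
matrix. -/
def invSqrt {h : ℕ} (A : Matrix (Fin h) (Fin h) ℝ) : Matrix (Fin h) (Fin h) ℝ :=
  CFC.sqrt A⁻¹

/-- Some entry of `A` has absolute value at least `ε`. -/
def EntryGE {h : ℕ} (ε : ℝ) (A : Matrix (Fin h) (Fin h) ℝ) : Prop :=
  ∃ i j, ε ≤ |A i j|

/-- The `m`-fold product of a Markov kernel with itself: given `a`, the `m` coordinates are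
independent, each with law `κ a`. -/
def iidKernel {α β : Type*} [MeasurableSpace α] [MeasurableSpace β] (m : ℕ) (κ : Kernel α β)
    [IsMarkovKernel κ] : Kernel α (Fin m → β) where
  toFun a := Measure.pi (fun _ => κ a)
  measurable' := by
    refine Measurable.measure_of_isPiSystem_of_isProbabilityMeasure
      generateFrom_pi.symm isPiSystem_pi ?_
    rintro _ ⟨s, hs, rfl⟩
    simp only [Measure.pi_pi]
    exact Finset.measurable_prod _ fun i _ => κ.measurable_coe (hs i (Set.mem_univ i))

instance {α β : Type*} [MeasurableSpace α] [MeasurableSpace β] (m : ℕ) (κ : Kernel α β)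
    [IsMarkovKernel κ] : IsMarkovKernel (iidKernel m κ) where
  isProbabilityMeasure a := by
    change IsProbabilityMeasure (Measure.pi (fun _ => κ a))
    infer_instance

/-- A sequence, indexed by the sample size `n`, of parametric models for complete data
`X = (X_obs, X_mis)` with a common parameter set `Ψ`, together with an imputation model.

The reference measure is `obsRef n (do) * misRef n o (dx)`. So `o` may contain the pattern of
missingness (the part of the data that is missing may vary with `o`), and the factor contributed by
an ignorable missing-data mechanism, being a function of `o` alone, may be a part of `obsRef`. -/
structure MIModel.{u} (h : ℕ) where
  /-- The parameter set. -/
  Ψ : Set (EuclideanSpace ℝ (Fin h))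
  isOpen_Ψ : IsOpen Ψ
  /-- The space of the observed parts of data sets of size `n`. -/
  Obs : ℕ → Type u
  /-- The space of the missing parts of data sets of size `n`. -/
  Mis : ℕ → Type u
  measObs : ∀ n, MeasurableSpace (Obs n)
  measMis : ∀ n, MeasurableSpace (Mis n)
  obsRef : ∀ n, Measure (Obs n)
  sigmaFinite_obsRef : ∀ n, SigmaFinite (obsRef n)
  misRef : ∀ n, Kernel (Obs n) (Mis n)
  sFinite_misRef : ∀ n, IsSFiniteKernel (misRef n)
  /-- The sampling density `f(X ∣ ψ)`. -/
  density : ∀ n, EuclideanSpace ℝ (Fin h) → Obs n × Mis n → ℝ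
  density_nonneg : ∀ n ψ x, 0 ≤ density n ψ x
  measurable_density : ∀ n, Measurable (Function.uncurry (density n))
  lintegral_density : ∀ n, ∀ ψ ∈ Ψ,
    ∫⁻ x, ENNReal.ofReal (density n ψ x) ∂(obsRef n ⊗ₘ misRef n) = 1
  /-- The imputation model: the law from which `X_mis` is imputed, given `X_obs`. -/
  impute : ∀ n, Kernel (Obs n) (Mis n)
  markov_impute : ∀ n, IsMarkovKernel (impute n)

namespace MIModel

attribute [instance] MIModel.measObs MIModel.measMis MIModel.sigmaFinite_obsRef
  MIModel.sFinite_misRef MIModel.markov_impute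

variable {h : ℕ} (M : MIModel h)

/-- The law of the complete data `X` under the parameter `ψ`. -/
def law (n : ℕ) (ψ : M.Ψ) : Measure (M.Obs n × M.Mis n) :=
  (M.obsRef n ⊗ₘ M.misRef n).withDensity (fun x => ENNReal.ofReal (M.density n ψ x))

instance (n : ℕ) (ψ : M.Ψ) : IsProbabilityMeasure (M.law n ψ) where
  measure_univ := by
    rw [law, withDensity_apply _ MeasurableSet.univ, setLIntegral_univ]
    exact M.lintegral_density n ψ ψ.2

/-- The law of the observed data `X_obs` under the parameter `ψ`. -/
def obsLaw (n : ℕ) (ψ : M.Ψ) : Measure (M.Obs n) :=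
  (M.law n ψ).map Prod.fst

instance (n : ℕ) (ψ : M.Ψ) : IsProbabilityMeasure (M.obsLaw n ψ) :=
  Measure.isProbabilityMeasure_map measurable_fst.aemeasurable

/-- The law of one completed data set `X^ℓ = (X_obs, X_mis^ℓ)`, when `X_obs` is sampled under
`ψ`. -/
def completedLaw (n : ℕ) (ψ : M.Ψ) : Measure (M.Obs n × M.Mis n) :=
  M.obsLaw n ψ ⊗ₘ M.impute n

/-- The joint law of `X_obs` and `m` imputations `X_mis^1, …, X_mis^m`, which are independent given
`X_obs`. -/
def miLaw (m n : ℕ) (ψ : M.Ψ) : Measure (M.Obs n × (Fin m → M.Mis n)) :=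
  M.obsLaw n ψ ⊗ₘ iidKernel m (M.impute n)

instance (m n : ℕ) (ψ : M.Ψ) : IsProbabilityMeasure (M.miLaw m n ψ) := by
  unfold miLaw
  infer_instance

/-- The `ℓ`-th completed data set. -/
def completed {m n : ℕ} (ω : M.Obs n × (Fin m → M.Mis n)) (ℓ : Fin m) : M.Obs n × M.Mis n :=
  (ω.1, ω.2 ℓ)

/-- The log-likelihood `log f(x ∣ ψ)`. -/
def logLik (n : ℕ) (x : M.Obs n × M.Mis n) (ψ : EuclideanSpace ℝ (Fin h)) : ℝ :=
  Real.log (M.density n ψ x)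

/-- The observed-data likelihood `∫ f(o, y ∣ ψ) dy`. -/
def obsLik (n : ℕ) (o : M.Obs n) (ψ : EuclideanSpace ℝ (Fin h)) : ℝ≥0∞ :=
  ∫⁻ y, ENNReal.ofReal (M.density n ψ (o, y)) ∂(M.misRef n o)

/-- The average `m⁻¹ ∑ ℓ, log f(X^ℓ ∣ ψ^ℓ)`, as a function of `m` parameter vectors. -/
def avgLogLik {m n : ℕ} (ω : M.Obs n × (Fin m → M.Mis n))
    (ψ : Fin m → EuclideanSpace ℝ (Fin h)) : ℝ :=
  (∑ ℓ, M.logLik n (M.completed ω ℓ) (ψ ℓ)) / (m : ℝ)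

/-- The observed information `I(ψ) = - ∂² log f(x ∣ ψ) / ∂ψ ∂ψᵀ`. -/
def info (n : ℕ) (x : M.Obs n × M.Mis n) (ψ : EuclideanSpace ℝ (Fin h)) :
    Matrix (Fin h) (Fin h) ℝ :=
  Matrix.of fun i j => -fderiv ℝ (fderiv ℝ (M.logLik n x)) ψ
    (EuclideanSpace.single i 1) (EuclideanSpace.single j 1)

/-- The estimators of `ψ` used with `m` imputations, as functions of the data: the complete-data
MLE, the observed-data MLE, and the maximizer of the average log-likelihood of the `m` completed
data sets. -/
structure Estimators (m : ℕ) where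
  complete : ∀ n, M.Obs n × M.Mis n → EuclideanSpace ℝ (Fin h)
  measurable_complete : ∀ n, Measurable (complete n)
  observed : ∀ n, M.Obs n → EuclideanSpace ℝ (Fin h)
  measurable_observed : ∀ n, Measurable (observed n)
  pooled : ∀ n, M.Obs n × (Fin m → M.Mis n) → EuclideanSpace ℝ (Fin h)
  measurable_pooled : ∀ n, Measurable (pooled n)

variable {M}

/-- For the data set `x` the log-likelihood is twice continuously differentiable, and `ψhat`
maximizes it and is the only solution in `Ψ` of the score equation. -/
structure IsRegularMLE (n : ℕ) (x : M.Obs n × M.Mis n) (ψhat : EuclideanSpace ℝ (Fin h)) :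
    Prop where
  density_pos : ∀ ψ ∈ M.Ψ, 0 < M.density n ψ x
  contDiffOn : ContDiffOn ℝ 2 (M.logLik n x) M.Ψ
  mem : ψhat ∈ M.Ψ
  isMaxOn : IsMaxOn (M.logLik n x) M.Ψ ψhat
  score_eq_zero_iff : ∀ ψ ∈ M.Ψ, fderiv ℝ (M.logLik n x) ψ = 0 ↔ ψ = ψhat

/-- The regularity conditions at the true value `ψ` of the parameter.

`J` is the limiting information per observation, `T n` is the matrix `𝒯` of sample size `n`, and
`r` is the odds of the missing information. The matrix `𝒰` of sample size `n` is `(n J)⁻¹`, and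
`𝓑 = 𝒯 - 𝒰`. -/
structure RegularityConditions {m : ℕ} (est : M.Estimators m) (ψ : M.Ψ)
    (J : Matrix (Fin h) (Fin h) ℝ) (T : ℕ → Matrix (Fin h) (Fin h) ℝ) (r : ℝ) : Prop where
  /-- Smooth log-likelihood, and a complete-data MLE that is the only root of the score; for the
  complete data and for completed data. -/
  regular_law : ∀ᶠ n in atTop, ∀ᵐ x ∂M.law n ψ, IsRegularMLE n x (est.complete n x)
  regular_completed : ∀ᶠ n in atTop, ∀ᵐ x ∂M.completedLaw n ψ, IsRegularMLE n x (est.complete n x)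
  /-- `est.observed` is the observed-data MLE. -/
  observed_mle : ∀ᶠ n in atTop, ∀ᵐ o ∂M.obsLaw n ψ,
    est.observed n o ∈ M.Ψ ∧ IsMaxOn (M.obsLik n o) M.Ψ (est.observed n o)
  /-- `est.pooled` maximizes the average log-likelihood. -/
  pooled_mle : ∀ᶠ n in atTop, ∀ᵐ ω ∂M.miLaw m n ψ,
    est.pooled n ω ∈ M.Ψ ∧ IsMaxOn (fun ψ' => M.avgLogLik ω (fun _ => ψ')) M.Ψ (est.pooled n ω)
  posDef : J.PosDef
  /-- The observed information per observation of the complete data tends to `J` in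
  probability. -/
  info_tendsto : ∀ ε > 0, Tendsto
    (fun n : ℕ => M.law n ψ {x | EntryGE ε ((n : ℝ)⁻¹ • M.info n x ψ - J)}) atTop (𝓝 0)
  /-- `𝒯^(-1/2) (ψhat_obs - ψ) ⇒ N(0, I)`. -/
  observed_normal : TendstoInDistribution
    (fun n o => matVec (invSqrt (T n)) (est.observed n o - ψ)) atTop
    (fun z : EuclideanSpace ℝ (Fin h) => z) (fun n => M.obsLaw n ψ)
    (stdGaussian (EuclideanSpace ℝ (Fin h)))
  /-- Proper imputation: the conditional law given `X_obs` of `𝓑^(-1/2) (ψhat^ℓ - ψhat_obs)`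
  converges weakly to `N(0, I)`, in probability. -/
  imputed_normal : ∀ g : EuclideanSpace ℝ (Fin h) →ᵇ ℝ, ∀ ε > 0, Tendsto
    (fun n : ℕ => M.obsLaw n ψ {o | ε ≤
      |(∫ y, g (matVec (invSqrt (T n - ((n : ℝ) • J)⁻¹))
          (est.complete n (o, y) - est.observed n o)) ∂(M.impute n o))
        - ∫ z, g z ∂(stdGaussian (EuclideanSpace ℝ (Fin h)))|}) atTop (𝓝 0)
  /-- Proper imputation, lower-order variability: `𝒯⁻¹ (U^ℓ - 𝒰)` tends to zero in probability,
  where `U^ℓ` is the inverse of the observed information of `X^ℓ`, at all parameter values near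
  `ψ`. (Convergence to zero of the conditional probabilities given `X_obs`, in probability, is
  the same as convergence to zero of the probabilities.) -/
  imputed_info : ∀ ε > 0, ∃ δ > 0, Tendsto
    (fun n : ℕ => M.completedLaw n ψ {x | ∃ ψ' ∈ M.Ψ, ‖ψ' - ψ‖ < δ ∧
      EntryGE ε ((T n)⁻¹ * ((M.info n x ψ')⁻¹ - ((n : ℝ) • J)⁻¹))}) atTop (𝓝 0)
  /-- Well-separated maximum: away from `ψ` the log-likelihood per observation of a completed data
  set stays below its value at `ψ`. -/
  separated : ∀ ε > 0, ∃ δ > 0, Tendsto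
    (fun n : ℕ => M.completedLaw n ψ {x | ∃ ψ' ∈ M.Ψ, ε ≤ ‖ψ' - ψ‖ ∧
      (n : ℝ)⁻¹ * M.logLik n x ψ - δ < (n : ℝ)⁻¹ * M.logLik n x ψ'}) atTop (𝓝 0)
  /-- Equal fraction of missing information; `𝓑` is invertible. -/
  r_pos : 0 < r
  efmi : ∀ n : ℕ, 0 < n → T n = (1 + r) • ((n : ℝ) • J)⁻¹

/-- The estimator `r̂^◇ = (m + 1) / (h (m - 1)) (δbar - δhat)`, where
`δbar = 2 Lbar(ψhat^1, …, ψhat^m)` and `δhat = 2 Lbar(ψhat*, …, ψhat*)`. -/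
def rRob {m : ℕ} (est : M.Estimators m) (n : ℕ) (ω : M.Obs n × (Fin m → M.Mis n)) : ℝ :=
  ((m : ℝ) + 1) / ((h : ℝ) * ((m : ℝ) - 1)) *
    (2 * M.avgLogLik ω (fun ℓ => est.complete n (M.completed ω ℓ))
      - 2 * M.avgLogLik ω (fun _ => est.pooled n ω))

/-- The finite-`m` odds `r_m = (1 + 1 / m) r`. -/
def rM (m : ℕ) (r : ℝ) : ℝ := (1 + 1 / (m : ℝ)) * r

/-- `ψ₀` is the maximizer of the average log-likelihood under the constraint `θ(ψ) = θ₀`, when the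
observed data are sampled under `ψ`. -/
def IsConstrainedMLE {m k : ℕ} (ψ : M.Ψ)
    (θ : EuclideanSpace ℝ (Fin h) → EuclideanSpace ℝ (Fin k)) (θ₀ : EuclideanSpace ℝ (Fin k))
    (ψ₀ : ∀ n, M.Obs n × (Fin m → M.Mis n) → EuclideanSpace ℝ (Fin h)) : Prop :=
  ∀ᶠ n in atTop, ∀ᵐ ω ∂M.miLaw m n ψ, (ψ₀ n ω ∈ M.Ψ ∧ θ (ψ₀ n ω) = θ₀) ∧
    IsMaxOn (fun ψ' => M.avgLogLik ω (fun _ => ψ')) {ψ' | ψ' ∈ M.Ψ ∧ θ ψ' = θ₀} (ψ₀ n ω)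

/-- The combined likelihood ratio statistic `dhat = 2 (Lbar(ψhat*) - Lbar(ψhat₀*))`, divided by
`k (1 + r_m)`. -/
def lrtNumerator {m : ℕ} (est : M.Estimators m) (k : ℕ) (r : ℝ)
    (ψ₀ : ∀ n, M.Obs n × (Fin m → M.Mis n) → EuclideanSpace ℝ (Fin h))
    (n : ℕ) (ω : M.Obs n × (Fin m → M.Mis n)) : ℝ :=
  2 * (M.avgLogLik ω (fun _ => est.pooled n ω) - M.avgLogLik ω (fun _ => ψ₀ n ω)) /
    ((k : ℝ) * (1 + rM m r))

end MIModel

end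

/-! Let `w₀ = 𝒯^(-1/2) (ψ̂_obs - ψ)` and `w_ℓ = 𝓑^(-1/2) (ψ̂^ℓ - ψ̂_obs)`. Condition on `X_obs`: the
characteristic function of `(w₀, w₁, …, w_m)` is the mean of a unimodular factor in `w₀` times `m`
conditional characteristic functions, which converge in probability to constants. So the array tends
to `m + 1` independent standard Gaussian vectors (`tendstoInDistribution_of_conditional`). Equal
fractions of missing information make `𝒯` and `𝓑` multiples of `𝒰`, whence `√n J^(1/2) (ψ̂^ℓ - ψ) =
√(1 + r) w₀ + √r w_ℓ` (`shifted_stdEst`).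

The score vanishes at `ψ̂^ℓ` and the information is nearly `n J` close to `ψ`, so twice the loss of
log-likelihood from `ψ̂^ℓ` to a nearby `x` is `n ‖J^(1/2) (x - ψ̂^ℓ)‖²` up to a small relative
error. The average over `ℓ` is the variance of the standardized `ψ̂^ℓ` plus the squared distance
from the standardized `x` to their mean. Well-separation keeps the maximizers near `ψ`. Hence the
minimal loss is asymptotically the variance (`tendsto_loss_pooled`). Under the constraint, whose
level set is nearly its tangent space, the squared distance of the mean to that space is added
(`tendsto_loss_constrained`).

Thus `r̂` is governed by the variance, which does not involve `w₀`. After scaling it is the squared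
length of the projection of the array to a subspace of dimension `h (m - 1)`. The numerator `d̂` is
governed by the mean, which is `√(1 + r_m)` times a standard Gaussian vector, projected to the
`k`-dimensional orthogonal complement of the tangent space. Mean and deviations of a Gaussian sample
are independent, and Slutsky's lemma carries both limits over. -/

/-! ### Second-order expansion at a critical point -/

/-- A function on `[0, 1]` with vanishing derivative at `0` and second derivative at most `c`
grows by at most `c / 2`. -/
theorem sub_le_half_of_second_deriv_le {g g' g'' : ℝ → ℝ} {c : ℝ}
    (hg : ∀ t ∈ Set.Icc (0 : ℝ) 1, HasDerivAt g (g' t) t)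
    (hg' : ∀ t ∈ Set.Icc (0 : ℝ) 1, HasDerivAt g' (g'' t) t)
    (h0 : g' 0 = 0) (hc : ∀ t ∈ Set.Icc (0 : ℝ) 1, g'' t ≤ c) :
    g 1 - g 0 ≤ c / 2 := by
  have h1 : ∀ t ∈ Set.Icc (0 : ℝ) 1, g' t ≤ c * t := by
    intro t ht
    have := (convex_Icc (0 : ℝ) 1).image_sub_le_mul_sub_of_deriv_le (f := g') (C := c)
      (fun x hx => (hg' x hx).continuousAt.continuousWithinAt)
      (fun x hx => (hg' x (interior_subset hx)).differentiableAt.differentiableWithinAt)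
      (fun x hx => by rw [(hg' x (interior_subset hx)).deriv]; exact hc x (interior_subset hx))
      0 (by simp) t ht ht.1
    simpa [h0] using this
  have hk : ∀ t ∈ Set.Icc (0 : ℝ) 1,
      HasDerivAt (fun t => g t - c / 2 * t ^ 2) (g' t - c * t) t := by
    intro t ht
    exact ((hg t ht).sub ((hasDerivAt_pow 2 t).const_mul (c / 2))).congr_deriv
      (by norm_num; ring)
  have := (convex_Icc (0 : ℝ) 1).image_sub_le_mul_sub_of_deriv_le
      (f := fun t => g t - c / 2 * t ^ 2) (C := 0)
      (fun x hx => (hk x hx).continuousAt.continuousWithinAt)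
      (fun x hx => (hk x (interior_subset hx)).differentiableAt.differentiableWithinAt)
      (fun x hx => by
        rw [(hk x (interior_subset hx)).deriv]; linarith [h1 x (interior_subset hx)])
      0 (by simp) 1 (by simp) zero_le_one
  norm_num at this
  linarith

/-- Near a critical point, a function whose second derivative is close to a quadratic form is
close to that quadratic form. -/
theorem abs_two_mul_sub_sub_le_of_hessian_close {E : Type*} [NormedAddCommGroup E]
    [NormedSpace ℝ E] {f : E → ℝ} {B : Set E} (hB : IsOpen B) (hBc : Convex ℝ B)
    (hf : ContDiffOn ℝ 2 f B) {a b : E} (ha : a ∈ B) (hb : b ∈ B) (h0 : fderiv ℝ f a = 0)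
    {q ε : ℝ} (hq : ∀ x ∈ B, |-fderiv ℝ (fderiv ℝ f) x (b - a) (b - a) - q| ≤ ε) :
    |2 * (f a - f b) - q| ≤ ε := by
  have hmem : ∀ t ∈ Set.Icc (0 : ℝ) 1, a + t • (b - a) ∈ B := fun t ht =>
    hBc.add_smul_sub_mem ha hb ht
  have hd : ∀ x ∈ B, HasFDerivAt f (fderiv ℝ f x) x := fun x hx =>
    ((hf.contDiffAt (hB.mem_nhds hx)).differentiableAt (by norm_num)).hasFDerivAt
  have hdd : ∀ x ∈ B, HasFDerivAt (fderiv ℝ f) (fderiv ℝ (fderiv ℝ f) x) x := fun x hx =>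
    (((hf.contDiffAt (hB.mem_nhds hx)).fderiv_right (m := 1) (by norm_num)).differentiableAt
      (by norm_num)).hasFDerivAt
  have hline : ∀ t : ℝ, HasDerivAt (fun t : ℝ => a + t • (b - a)) (b - a) t := fun t => by
    simpa using ((hasDerivAt_id t).smul_const (b - a)).const_add a
  have hg : ∀ t ∈ Set.Icc (0 : ℝ) 1, HasDerivAt (fun t : ℝ => f (a + t • (b - a)))
      (fderiv ℝ f (a + t • (b - a)) (b - a)) t := fun t ht =>
    (hd _ (hmem t ht)).comp_hasDerivAt t (hline t)
  have hg' : ∀ t ∈ Set.Icc (0 : ℝ) 1,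
      HasDerivAt (fun t : ℝ => fderiv ℝ f (a + t • (b - a)) (b - a))
      (fderiv ℝ (fderiv ℝ f) (a + t • (b - a)) (b - a) (b - a)) t := fun t ht => by
    have h : HasDerivAt (fun t : ℝ => fderiv ℝ f (a + t • (b - a)))
        (fderiv ℝ (fderiv ℝ f) (a + t • (b - a)) (b - a)) t :=
      (hdd _ (hmem t ht)).comp_hasDerivAt t (hline t)
    exact (ContinuousLinearMap.apply ℝ ℝ (b - a)).hasFDerivAt.comp_hasDerivAt t h
  have hzero : fderiv ℝ f (a + (0 : ℝ) • (b - a)) (b - a) = 0 := by simp [h0]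
  -- The two halves of the absolute value come from `f` and from `-f` along the segment, whose
  -- second derivatives are at most `ε - q` and `ε + q`.
  have h1 := sub_le_half_of_second_deriv_le hg hg' hzero (c := ε - q)
    (fun t ht => by have := abs_le.1 (hq _ (hmem t ht)); linarith)
  have h2 := sub_le_half_of_second_deriv_le (fun t ht => (hg t ht).neg)
    (fun t ht => (hg' t ht).neg) (by simp [h0]) (c := ε + q)
    (fun t ht => by have := abs_le.1 (hq _ (hmem t ht)); linarith)
  simp at h1 h2
  rw [abs_le]
  constructor <;> linarith

/-- Arithmetic for the constrained minimum: `V` is the variance, `s` the distance from the mean to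
the subspace, `n` that from the mean to the minimizer, `d` the minimal loss. The constants 10 and 40
are not sharp. -/
theorem abs_sub_le_of_sandwich {ε V s R n d : ℝ} (hε0 : 0 ≤ ε) (hε : ε ≤ 1)
    (hVR : V ≤ R ^ 2) (hs0 : 0 ≤ s) (hsR : s ≤ R) (hsn : s - ε * R ≤ (1 + ε) * n)
    (hlow : (1 - ε) * (V + n ^ 2) ≤ d) (hup : d ≤ (1 + ε) * (V + (s + ε * R) ^ 2)) :
    |d - (V + s ^ 2)| ≤ 40 * ε * R ^ 2 := by
  have hR0 : 0 ≤ R := hs0.trans hsR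
  have heR : 0 ≤ ε * R ^ 2 := by positivity
  have heR1 : 0 ≤ ε * R := by positivity
  have hs2 : s ^ 2 ≤ R ^ 2 := by gcongr
  have hsR2 : s * R ≤ R ^ 2 := by nlinarith
  have hee : ε * (ε * R ^ 2) ≤ ε * R ^ 2 := by nlinarith
  have hesR : ε * (s * R) ≤ ε * R ^ 2 := by gcongr
  have heV : ε * V ≤ ε * R ^ 2 := by gcongr
  have hes : ε * s ^ 2 ≤ ε * R ^ 2 := by gcongr
  have hlow' : s ^ 2 - 10 * (ε * R ^ 2) ≤ n ^ 2 := by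
    by_cases hcase : s ≤ n
    · have : s ^ 2 ≤ n ^ 2 := by gcongr
      linarith
    -- Here `n < s ≤ R`, so `ε * n` is at most `ε * R` and the factor `1 + ε` becomes an additive
    -- error.
    · push Not at hcase
      have h9 : s ≤ n + 2 * (ε * R) := by nlinarith
      have h10 : s ^ 2 ≤ (n + 2 * (ε * R)) ^ 2 := by gcongr
      have h11 : ε * R * n ≤ ε * R * R := by gcongr; linarith
      nlinarith
  rw [abs_le]
  constructor
  · have : (1 - ε) * (V + (s ^ 2 - 10 * (ε * R ^ 2))) ≤ (1 - ε) * (V + n ^ 2) := by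
      gcongr
    nlinarith
  · have e1 : (s + ε * R) ^ 2 ≤ s ^ 2 + 3 * (ε * R ^ 2) := by nlinarith
    have e2 : (1 + ε) * (V + (s + ε * R) ^ 2) ≤ (1 + ε) * (V + (s ^ 2 + 3 * (ε * R ^ 2))) := by
      gcongr
    nlinarith

/-! ### Minimizing an average of nearly quadratic losses -/

section Minimization

variable {E : Type*} [NormedAddCommGroup E] [InnerProductSpace ℝ E]

/-- The mean of finitely many vectors. -/
noncomputable def avgVec {m : ℕ} (y : Fin m → E) : E := (m : ℝ)⁻¹ • ∑ ℓ, y ℓ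

/-- The mean squared distance of finitely many vectors to their mean. -/
noncomputable def avgVar {m : ℕ} (y : Fin m → E) : ℝ :=
  (m : ℝ)⁻¹ * ∑ ℓ, ‖y ℓ - avgVec y‖ ^ 2

theorem sum_sub_avgVec {m : ℕ} (hm : 0 < m) (y : Fin m → E) : ∑ ℓ, (y ℓ - avgVec y) = 0 := by
  have : (m : ℝ) ≠ 0 := by positivity
  rw [Finset.sum_sub_distrib, Finset.sum_const, avgVec, Finset.card_univ, Fintype.card_fin,
    ← Nat.cast_smul_eq_nsmul ℝ, smul_smul, mul_inv_cancel₀ this, one_smul, sub_self]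

/-- Bias-variance decomposition: the cross terms vanish because the deviations from the mean sum to
zero. -/
theorem avg_norm_sub_sq {m : ℕ} (hm : 0 < m) (y : Fin m → E) (u : E) :
    (m : ℝ)⁻¹ * ∑ ℓ, ‖u - y ℓ‖ ^ 2 = avgVar y + ‖u - avgVec y‖ ^ 2 := by
  have hm' : (m : ℝ) ≠ 0 := by positivity
  have h : ∀ ℓ, ‖u - y ℓ‖ ^ 2 = ‖u - avgVec y‖ ^ 2
      - 2 * inner ℝ (u - avgVec y) (y ℓ - avgVec y) + ‖y ℓ - avgVec y‖ ^ 2 := fun ℓ => by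
    rw [← norm_sub_sq_real]; congr 2; abel
  simp_rw [h, Finset.sum_add_distrib, Finset.sum_sub_distrib, ← Finset.mul_sum, ← inner_sum,
    sum_sub_avgVec hm]
  simp [avgVar]
  field_simp
  ring

theorem norm_avgVec_le {m : ℕ} (hm : 0 < m) (y : Fin m → E) {R : ℝ} (hy : ∀ ℓ, ‖y ℓ‖ ≤ R) :
    ‖avgVec y‖ ≤ R := by
  have hm' : (0 : ℝ) < m := by positivity
  rw [avgVec, norm_smul, norm_inv, Real.norm_natCast, inv_mul_le_iff₀ hm']
  calc ‖∑ ℓ, y ℓ‖ ≤ ∑ ℓ, ‖y ℓ‖ := norm_sum_le _ _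
    _ ≤ ∑ _ℓ : Fin m, R := Finset.sum_le_sum fun ℓ _ => hy ℓ
    _ = m * R := by simp

theorem avgVar_le {m : ℕ} (hm : 0 < m) (y : Fin m → E) {R : ℝ} (hy : ∀ ℓ, ‖y ℓ‖ ≤ R) :
    avgVar y ≤ R ^ 2 := by
  have hm' : (0 : ℝ) < m := by positivity
  have := avg_norm_sub_sq hm y 0
  have h2 : (m : ℝ)⁻¹ * ∑ ℓ, ‖0 - y ℓ‖ ^ 2 ≤ R ^ 2 := by
    rw [inv_mul_le_iff₀ hm']
    calc ∑ ℓ, ‖0 - y ℓ‖ ^ 2 ≤ ∑ _ℓ : Fin m, R ^ 2 := Finset.sum_le_sum fun ℓ _ => by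
          rw [zero_sub, norm_neg]; gcongr; exact hy ℓ
      _ = m * R ^ 2 := by simp
  nlinarith [sq_nonneg ‖0 - avgVec y‖]

/-- Twice the average loss of fit at `x`, compared with the separate maximizers `a`. -/
noncomputable def avgLoss {m : ℕ} (L : Fin m → E → ℝ) (a : Fin m → E) (x : E) : ℝ :=
  (m : ℝ)⁻¹ * ∑ ℓ, 2 * (L ℓ (a ℓ) - L ℓ x)

variable {m : ℕ} {L : Fin m → E → ℝ} {a : Fin m → E} {p : E} {S : E →L[ℝ] E} {N ε : ℝ}
  {B : Set E}

/-- Errors relative to each quadratic term add up to an error relative to their average, which the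
bias-variance decomposition evaluates. The base point `p` cancels from the differences; it will be
the true parameter. -/
theorem abs_avgLoss_sub_le (hm : 0 < m) (hN : 0 ≤ N) {x : E}
    (hL : ∀ ℓ, |2 * (L ℓ (a ℓ) - L ℓ x) - N * ‖S (x - a ℓ)‖ ^ 2| ≤ ε * (N * ‖S (x - a ℓ)‖ ^ 2)) :
    |avgLoss L a x - (avgVar (fun ℓ => √N • S (a ℓ - p))
        + ‖√N • S (x - p) - avgVec (fun ℓ => √N • S (a ℓ - p))‖ ^ 2)|
      ≤ ε * (avgVar (fun ℓ => √N • S (a ℓ - p))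
        + ‖√N • S (x - p) - avgVec (fun ℓ => √N • S (a ℓ - p))‖ ^ 2) := by
  have hm' : (0 : ℝ) < m := by positivity
  rw [← avg_norm_sub_sq hm]
  have hu : ∀ ℓ, ‖√N • S (x - p) - √N • S (a ℓ - p)‖ ^ 2 = N * ‖S (x - a ℓ)‖ ^ 2 := fun ℓ => by
    rw [← smul_sub, ← map_sub, norm_smul, mul_pow, Real.norm_eq_abs, sq_abs, Real.sq_sqrt hN]
    congr 4; abel
  simp_rw [hu, avgLoss]
  rw [← mul_sub, ← Finset.sum_sub_distrib, abs_mul, abs_of_pos (inv_pos.2 hm'), mul_left_comm,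
    Finset.mul_sum]
  gcongr
  exact (Finset.abs_sum_le_sum_abs _ _).trans (Finset.sum_le_sum fun ℓ _ => hL ℓ)

/-- The minimal average loss is nearly the variance of the separate maximizers. -/
theorem abs_avgLoss_min_sub_le (hm : 0 < m) (hN : 0 ≤ N) (hε : ε ≤ 1)
    (hL : ∀ x ∈ B, ∀ ℓ,
      |2 * (L ℓ (a ℓ) - L ℓ x) - N * ‖S (x - a ℓ)‖ ^ 2| ≤ ε * (N * ‖S (x - a ℓ)‖ ^ 2))
    {x : E} (hx : x ∈ B) (hmin : ∀ z ∈ B, avgLoss L a x ≤ avgLoss L a z)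
    {z : E} (hz : z ∈ B) (hzy : √N • S (z - p) = avgVec (fun ℓ => √N • S (a ℓ - p))) :
    |avgLoss L a x - avgVar (fun ℓ => √N • S (a ℓ - p))|
      ≤ ε * avgVar (fun ℓ => √N • S (a ℓ - p)) := by
  have h1 := abs_le.1 (abs_avgLoss_sub_le (p := p) hm hN (hL x hx))
  have h2 := abs_le.1 (abs_avgLoss_sub_le (p := p) hm hN (hL z hz))
  rw [hzy, sub_self] at h2
  have h3 := hmin z hz
  -- The lower bound drops the squared distance of `x` to the mean, which has the factor `1 - ε ≥
  -- 0`; the upper bound compares with `z`, where this distance is zero.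
  have h4 := mul_nonneg (sub_nonneg.2 hε)
    (sq_nonneg ‖√N • S (x - p) - avgVec (fun ℓ => √N • S (a ℓ - p))‖)
  simp only [norm_zero, ne_eq, OfNat.ofNat_ne_zero, not_false_eq_true, zero_pow, add_zero] at h2
  rw [abs_le]
  constructor <;> nlinarith

variable [FiniteDimensional ℝ E]

/-- The minimal average loss over a set `C` that is nearly a subspace, in the scale `√N`, is nearly
the variance of the separate maximizers plus the squared distance of their mean to the
subspace. -/
theorem abs_avgLoss_constrained_min_sub_le (hm : 0 < m) (hN : 0 ≤ N) (hε0 : 0 ≤ ε) (hε : ε ≤ 1)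
    (hL : ∀ x ∈ B, ∀ ℓ,
      |2 * (L ℓ (a ℓ) - L ℓ x) - N * ‖S (x - a ℓ)‖ ^ 2| ≤ ε * (N * ‖S (x - a ℓ)‖ ^ 2))
    {R : ℝ} (hR : ∀ ℓ, ‖√N • S (a ℓ - p)‖ ≤ R) {K : Submodule ℝ E} {C : Set E}
    (hC : ∀ x ∈ C, x ∈ B → ∃ v ∈ K, ‖S (x - p) - v‖ ≤ ε * ‖S (x - p)‖)
    {x : E} (hxC : x ∈ C) (hx : x ∈ B)
    (hmin : ∀ z ∈ C, z ∈ B → avgLoss L a x ≤ avgLoss L a z)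
    {z : E} (hzC : z ∈ C) (hz : z ∈ B)
    (hzy : ‖√N • S (z - p) - K.starProjection (avgVec (fun ℓ => √N • S (a ℓ - p)))‖ ≤ ε * R) :
    |avgLoss L a x - (avgVar (fun ℓ => √N • S (a ℓ - p))
      + ‖Kᗮ.starProjection (avgVec (fun ℓ => √N • S (a ℓ - p)))‖ ^ 2)| ≤ 40 * ε * R ^ 2 := by
  set y := fun ℓ => √N • S (a ℓ - p) with hy
  set b := avgVec y with hb
  set V := avgVar y with hV
  have hbR : ‖b‖ ≤ R := norm_avgVec_le hm y hR
  have hVR : V ≤ R ^ 2 := avgVar_le hm y hR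
  set s := ‖Kᗮ.starProjection b‖ with hs
  have hs' : s = ‖b - K.starProjection b‖ := by rw [hs, Submodule.starProjection_orthogonal_val]
  have hs0 : 0 ≤ s := norm_nonneg _
  have hsR : s ≤ R := (Kᗮ.norm_starProjection_apply_le b).trans hbR
  have h1 := abs_le.1 (abs_avgLoss_sub_le (p := p) hm hN (hL x hx))
  have h2 := abs_le.1 (abs_avgLoss_sub_le (p := p) hm hN (hL z hz))
  have h3 := hmin z hzC hz
  rw [← hy, ← hb, ← hV] at h1 h2
  set u := √N • S (x - p) with hu
  set w := √N • S (z - p) with hw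
  have hwb : ‖w - b‖ ≤ s + ε * R := by
    calc ‖w - b‖ = ‖(w - K.starProjection b) - (b - K.starProjection b)‖ := by congr 1; abel
      _ ≤ ε * R + s := by rw [hs']; exact (norm_sub_le _ _).trans (by gcongr)
      _ = _ := add_comm _ _
  -- The minimizer is within `ε * ‖u‖` of `K`, so it cannot be much closer to `b` than `K` is.
  have hub : s - ε * R ≤ (1 + ε) * ‖u - b‖ := by
    obtain ⟨v, hv, hvx⟩ := hC x hxC hx
    have h5 : s ≤ ‖b - √N • v‖ := by
      rw [hs', Submodule.starProjection_minimal]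
      exact ciInf_le ⟨0, by rintro _ ⟨k, rfl⟩; exact norm_nonneg _⟩
        (⟨√N • v, K.smul_mem _ hv⟩ : K)
    have h6 : ‖u - √N • v‖ ≤ ε * ‖u‖ := by
      rw [hu, ← smul_sub, norm_smul, norm_smul, mul_left_comm]; gcongr
    have h7 : ‖b - √N • v‖ ≤ ‖u - b‖ + ‖u - √N • v‖ := by
      rw [norm_sub_rev u b]; exact norm_sub_le_norm_sub_add_norm_sub _ _ _
    have h8 : ‖u‖ ≤ ‖u - b‖ + ‖b‖ := by simpa using norm_add_le (u - b) b
    nlinarith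
  have hwb2 : ‖w - b‖ ^ 2 ≤ (s + ε * R) ^ 2 := by gcongr
  exact abs_sub_le_of_sandwich hε0 hε hVR hs0 hsR hub (by linarith)
    ((h3.trans (by linarith [h2.2])).trans
      (mul_le_mul_of_nonneg_left (add_le_add_right hwb2 V) (by linarith : 0 ≤ 1 + ε)))

end Minimization

/-! ### Level sets and their tangent spaces -/

section Constraint

variable {E F : Type*} [NormedAddCommGroup E] [NormedSpace ℝ E] [FiniteDimensional ℝ E]
  [NormedAddCommGroup F] [NormedSpace ℝ F] [FiniteDimensional ℝ F]

/-- Points of a level set are close to the tangent space. -/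
theorem exists_forall_mem_level_close_tangent {θ : E → F} {θ' : E →L[ℝ] F} {p : E}
    (hθ : HasFDerivAt θ θ' p) (hsurj : Function.Surjective θ') {ε : ℝ} (hε : 0 < ε) :
    ∃ δ > 0, ∀ x, ‖x - p‖ < δ → θ x = θ p → ∃ v ∈ θ'.ker, ‖(x - p) - v‖ ≤ ε * ‖x - p‖ := by
  -- On the level set `θ' (x - p)` is `o(‖x - p‖)`; a preimage of it of comparable size, subtracted
  -- from `x - p`, leaves a kernel vector.
  obtain ⟨C, hC, hCb⟩ := θ'.exists_preimage_norm_le hsurj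
  have := (hθ.isLittleO.def (c := ε / C) (by positivity))
  obtain ⟨δ, hδ, h⟩ := Metric.eventually_nhds_iff.1 this
  refine ⟨δ, hδ, fun x hx hxp => ?_⟩
  have h1 := h (by rwa [dist_eq_norm])
  obtain ⟨w, hw, hwb⟩ := hCb (θ' (x - p))
  refine ⟨(x - p) - w, by simp [hw], ?_⟩
  rw [hxp, sub_self, zero_sub, norm_neg] at h1
  calc ‖(x - p) - ((x - p) - w)‖ = ‖w‖ := by simp
    _ ≤ C * ‖θ' (x - p)‖ := hwb
    _ ≤ C * (ε / C * ‖x - p‖) := by gcongr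
    _ = ε * ‖x - p‖ := by field_simp

/-- Points of the tangent space are close to the level set. -/
theorem exists_forall_tangent_close_level {θ : E → F} {θ' : E →L[ℝ] F} {p : E}
    (hθ : HasStrictFDerivAt θ θ' p) (hsurj : Function.Surjective θ') {ε : ℝ} (hε : 0 < ε) :
    ∃ δ > 0, ∀ v ∈ θ'.ker, ‖v‖ < δ → ∃ x, θ x = θ p ∧ ‖(x - p) - v‖ ≤ ε * ‖v‖ := by
  have hrange : θ'.range = ⊤ := LinearMap.range_eq_top.2 hsurj
  -- The implicit function parametrizes the level set by the kernel, and its derivative at `0` is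
  -- the inclusion.
  set g := hθ.implicitFunction θ θ' hrange (θ p) with hg
  have h1 : HasStrictFDerivAt g θ'.ker.subtypeL 0 := hθ.to_implicitFunction hrange
  have h2 : ∀ᶠ y : θ'.ker in 𝓝 0, θ (g y) = θ p := by
    have := hθ.map_implicitFunction_eq hrange
    exact (this.curry_nhds.self_of_nhds)
  have h3 : g 0 = p := hθ.implicitFunction_apply_image hrange
  obtain ⟨δ, hδ, h⟩ := Metric.eventually_nhds_iff.1
    ((h1.hasFDerivAt.isLittleO.def hε).and h2)
  refine ⟨δ, hδ, fun v hv hvδ => ?_⟩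
  have := h (y := ⟨v, hv⟩) (by simpa [dist_eq_norm] using hvδ)
  refine ⟨g ⟨v, hv⟩, this.2, ?_⟩
  simpa [h3] using this.1

end Constraint

/-! ### Slutsky's lemma and tightness on varying probability spaces -/

section Slutsky

variable {E Ω' : Type*} {Ω : ℕ → Type*} {mΩ : ∀ n, MeasurableSpace (Ω n)}
  {μ : ∀ n, Measure (Ω n)} [∀ n, IsProbabilityMeasure (μ n)]
  {mΩ' : MeasurableSpace Ω'} {μ' : Measure Ω'} [IsProbabilityMeasure μ']
  [SeminormedAddCommGroup E] [MeasurableSpace E] [BorelSpace E]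

/-- Slutsky's lemma for random variables on varying probability spaces. -/
theorem tendstoInDistribution_of_sub_tendsto_zero [SecondCountableTopology E]
    {X Y : ∀ n, Ω n → E} {Z : Ω' → E}
    (hX : TendstoInDistribution X atTop Z μ μ') (hXm : ∀ n, Measurable (X n))
    (hYm : ∀ n, Measurable (Y n))
    (h : ∀ η > 0, Tendsto (fun n => μ n {ω | η ≤ ‖Y n ω - X n ω‖}) atTop (𝓝 0)) :
    TendstoInDistribution Y atTop Z μ μ' := by
  -- All samples are placed on one space, as coordinates of the infinite product. This keeps each
  -- law, and the joint law across different `n` is irrelevant.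
  have hev : ∀ n, MeasurePreserving (Function.eval n) (Measure.infinitePi μ) (μ n) := fun n =>
    measurePreserving_eval_infinitePi μ n
  have hmap : ∀ W : ∀ n, Ω n → E, (∀ n, Measurable (W n)) → ∀ n,
      (Measure.infinitePi μ).map (W n ∘ Function.eval n) = (μ n).map (W n) := fun W hW n => by
    rw [← Measure.map_map (hW n) (hev n).measurable, (hev n).map_eq]
  have key : TendstoInDistribution (fun n => Y n ∘ Function.eval n) atTop Z
      (fun _ => Measure.infinitePi μ) μ' := by
    refine tendstoInDistribution_of_tendstoInMeasure_sub (X := fun n => X n ∘ Function.eval n)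
      _ _ ⟨fun n => ((hXm n).comp (hev n).measurable).aemeasurable, hX.aemeasurable_limit, ?_⟩ ?_
      fun n => ((hYm n).comp (hev n).measurable).aemeasurable
    · have heq : (fun n => (⟨(μ n).map (X n), Measure.isProbabilityMeasure_map
          (hX.forall_aemeasurable n)⟩ : ProbabilityMeasure E)) = fun n =>
          ⟨(Measure.infinitePi μ).map (X n ∘ Function.eval n), Measure.isProbabilityMeasure_map
            ((hXm n).comp (hev n).measurable).aemeasurable⟩ :=
        funext fun n => Subtype.ext (hmap X hXm n).symm
      exact heq ▸ hX.tendsto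
    · rw [tendstoInMeasure_iff_norm]
      intro η hη
      refine tendsto_of_tendsto_of_tendsto_of_le_of_le tendsto_const_nhds (h η hη)
        (fun _ => bot_le) fun n => ?_
      rw [← (hev n).map_eq]
      refine le_trans (le_of_eq ?_) (Measure.le_map_apply (hev n).measurable.aemeasurable _)
      simp
  refine ⟨fun n => (hYm n).aemeasurable, hX.aemeasurable_limit, ?_⟩
  have heq : (fun n => (⟨(Measure.infinitePi μ).map (Y n ∘ Function.eval n),
      Measure.isProbabilityMeasure_map (key.forall_aemeasurable n)⟩ : ProbabilityMeasure E)) =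
      fun n => ⟨(μ n).map (Y n), Measure.isProbabilityMeasure_map (hYm n).aemeasurable⟩ :=
    funext fun n => Subtype.ext (hmap Y hYm n)
  exact heq ▸ key.tendsto

omit [∀ n, IsProbabilityMeasure (μ n)] in
/-- Convergence to zero in probability may be checked on the events on which a tight sequence is
bounded. -/
theorem tendsto_measure_zero_of_tight {G : Type*} [NormedAddCommGroup G]
    {Z : ∀ n, Ω n → G} {A : ∀ n, Set (Ω n)}
    (htight : ∀ ρ > 0, ∃ R : ℝ, ∀ n, μ n {ω | R < ‖Z n ω‖} ≤ ρ)
    (h : ∀ R : ℝ, Tendsto (fun n => μ n (A n ∩ {ω | ‖Z n ω‖ ≤ R})) atTop (𝓝 0)) :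
    Tendsto (fun n => μ n (A n)) atTop (𝓝 0) := by
  rw [ENNReal.tendsto_nhds_zero]
  intro ρ hρ
  obtain ⟨R, hR⟩ := htight (ρ / 2) (ENNReal.half_pos hρ.ne')
  filter_upwards [(ENNReal.tendsto_nhds_zero.1 (h R)) (ρ / 2) (ENNReal.half_pos hρ.ne')] with n hn
  calc μ n (A n) ≤ μ n (A n ∩ {ω | ‖Z n ω‖ ≤ R} ∪ {ω | R < ‖Z n ω‖}) :=
        measure_mono fun ω hω => by
          by_cases hc : ‖Z n ω‖ ≤ R
          · exact Or.inl ⟨hω, hc⟩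
          · exact Or.inr (not_le.1 hc)
    _ ≤ ρ / 2 + ρ / 2 := (measure_union_le _ _).trans (add_le_add hn (hR n))
    _ = ρ := ENNReal.add_halves ρ

/-- A sequence that converges in distribution is tight. -/
theorem exists_forall_measure_norm_gt_le {G : Type*} [NormedAddCommGroup G]
    [InnerProductSpace ℝ G] [FiniteDimensional ℝ G] [MeasurableSpace G] [BorelSpace G]
    {Z : ∀ n, Ω n → G} {W : Ω' → G} (hZ : TendstoInDistribution Z atTop W μ μ')
    (hZm : ∀ n, Measurable (Z n)) :
    ∀ ρ > 0, ∃ R : ℝ, ∀ n, μ n {ω | R < ‖Z n ω‖} ≤ ρ := by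
  intro ρ hρ
  have hchar := (ProbabilityMeasure.tendsto_iff_tendsto_charFun.1 hZ.tendsto)
  have := fun n => Measure.isProbabilityMeasure_map (hZm n).aemeasurable (μ := μ n)
  have := Measure.isProbabilityMeasure_map hZ.aemeasurable_limit
  -- Continuity at zero of the limiting characteristic function gives tightness of the whole
  -- sequence, so one `R` serves every `n`.
  have ht := isTightMeasureSet_of_tendsto_charFun (μ := fun n => (μ n).map (Z n))
    (f := charFun (μ'.map W)) continuous_charFun.continuousAt hchar
  have ht' := isTightMeasureSet_iff_tendsto_measure_norm_gt.1 ht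
  obtain ⟨R, hR⟩ := ((ENNReal.tendsto_nhds_zero.1 ht') ρ hρ).exists
  refine ⟨R, fun n => ?_⟩
  have h1 : (μ n).map (Z n) {x | R < ‖x‖} ≤ ρ :=
    le_trans (le_iSup₂ (f := fun (ν : Measure G) (_ : ν ∈ Set.range fun n => (μ n).map (Z n)) =>
      ν {x | R < ‖x‖}) _ ⟨n, rfl⟩) hR
  exact (Measure.le_map_apply (hZm n).aemeasurable _).trans h1

end Slutsky

/-! ### From conditional to joint convergence -/

section ConditionalConvergence

/-- Telescoping: factors are replaced one at a time, and the others have norm at most one. -/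
theorem norm_prod_sub_prod_le {ι : Type*} (s : Finset ι) {a b : ι → ℂ} (ha : ∀ i, ‖a i‖ ≤ 1)
    (hb : ∀ i, ‖b i‖ ≤ 1) : ‖∏ i ∈ s, a i - ∏ i ∈ s, b i‖ ≤ ∑ i ∈ s, ‖a i - b i‖ := by
  classical
  induction s using Finset.induction_on with
  | empty => simp
  | insert i s hi ih =>
    rw [Finset.prod_insert hi, Finset.prod_insert hi, Finset.sum_insert hi]
    have h1 : ‖∏ j ∈ s, a j‖ ≤ 1 := by
      rw [norm_prod]; exact Finset.prod_le_one (fun _ _ => norm_nonneg _) fun j _ => ha j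
    calc ‖a i * ∏ j ∈ s, a j - b i * ∏ j ∈ s, b j‖
        = ‖(a i - b i) * ∏ j ∈ s, a j + b i * (∏ j ∈ s, a j - ∏ j ∈ s, b j)‖ := by
          congr 1; ring
      _ ≤ ‖a i - b i‖ * ‖∏ j ∈ s, a j‖ + ‖b i‖ * ‖∏ j ∈ s, a j - ∏ j ∈ s, b j‖ := by
          refine (norm_add_le _ _).trans ?_
          rw [norm_mul, norm_mul]
      _ ≤ ‖a i - b i‖ * 1 + 1 * ∑ j ∈ s, ‖a j - b j‖ := by
          gcongr; exact hb i
      _ = _ := by ring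

/-- Bounded convergence: uniformly bounded functions that tend to zero in probability tend to zero
in mean. -/
theorem tendsto_integral_zero_of_tendsto_measure {Ω : ℕ → Type*} {mΩ : ∀ n, MeasurableSpace (Ω n)}
    {μ : ∀ n, Measure (Ω n)} [∀ n, IsProbabilityMeasure (μ n)] {f : ∀ n, Ω n → ℝ} {C : ℝ}
    (hfm : ∀ n, Measurable (f n)) (hf0 : ∀ n ω, 0 ≤ f n ω) (hfC : ∀ n ω, f n ω ≤ C)
    (h : ∀ ε > 0, Tendsto (fun n => μ n {ω | ε ≤ f n ω}) atTop (𝓝 0)) :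
    Tendsto (fun n => ∫ ω, f n ω ∂μ n) atTop (𝓝 0) := by
  have hC : 0 ≤ C := by
    obtain ⟨ω⟩ := nonempty_of_isProbabilityMeasure (μ 0)
    exact (hf0 0 ω).trans (hfC 0 ω)
  have hint : ∀ n, Integrable (f n) (μ n) := fun n =>
    Integrable.of_bound (hfm n).aestronglyMeasurable C
      (ae_of_all _ fun ω => by rw [Real.norm_of_nonneg (hf0 n ω)]; exact hfC n ω)
  have hle : ∀ ε > 0, ∀ n, ∫ ω, f n ω ∂μ n ≤ ε + C * (μ n).real {ω | ε ≤ f n ω} := by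
    intro ε hε n
    have hms : MeasurableSet {ω | ε ≤ f n ω} := measurableSet_le measurable_const (hfm n)
    calc ∫ ω, f n ω ∂μ n ≤ ∫ ω, (ε + {ω | ε ≤ f n ω}.indicator (fun _ => C) ω) ∂μ n := by
          refine integral_mono (hint n)
            ((integrable_const _).add ((integrable_const _).indicator hms)) fun ω => ?_
          by_cases hc : ε ≤ f n ω
          · simp only [Set.indicator, Set.mem_ofPred_eq, hc, if_true]
            linarith [hfC n ω]
          · simp only [Set.indicator, Set.mem_ofPred_eq, hc, if_false]
            linarith
      _ = _ := by
          rw [integral_add (integrable_const _) ((integrable_const _).indicator hms),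
            integral_indicator_const _ hms]
          simp [mul_comm]
  rw [Metric.tendsto_nhds]
  intro ε hε
  have h1 : Tendsto (fun n => ε / 2 + C * (μ n).real {ω | ε / 2 ≤ f n ω}) atTop
      (𝓝 (ε / 2 + C * 0)) := by
    refine tendsto_const_nhds.add (Tendsto.const_mul _ ?_)
    simpa [Measure.real, Function.comp_def] using (ENNReal.tendsto_toReal ENNReal.zero_ne_top).comp (h (ε / 2) (by positivity))
  filter_upwards [h1.eventually_lt_const (show ε / 2 + C * 0 < ε by linarith)] with n hn
  rw [dist_zero_right, Real.norm_of_nonneg (integral_nonneg (hf0 n))]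
  exact (hle _ (by positivity) n).trans_lt hn

variable {E : Type*} [NormedAddCommGroup E] [InnerProductSpace ℝ E] [FiniteDimensional ℝ E]
  [MeasurableSpace E] [BorelSpace E]

/-- The bounded continuous function `x ↦ cos ⟪x, t⟫`. -/
noncomputable def cosInner (t : E) : E →ᵇ ℝ :=
  BoundedContinuousFunction.ofNormedAddCommGroup (fun x => Real.cos (inner ℝ x t))
    (by fun_prop) 1 fun _ => Real.abs_cos_le_one _

/-- The bounded continuous function `x ↦ sin ⟪x, t⟫`. -/
noncomputable def sinInner (t : E) : E →ᵇ ℝ :=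
  BoundedContinuousFunction.ofNormedAddCommGroup (fun x => Real.sin (inner ℝ x t))
    (by fun_prop) 1 fun _ => Real.abs_sin_le_one _

-- Conditional convergence is tested on real functions, so the characteristic function is split into
-- cosine and sine parts.
omit [FiniteDimensional ℝ E] in
theorem integral_exp_inner_eq {α : Type*} {mα : MeasurableSpace α} (ν : Measure α)
    [IsFiniteMeasure ν] {f : α → E} (hf : Measurable f) (t : E) :
    ∫ y, Complex.exp (inner ℝ (f y) t * Complex.I) ∂ν
      = ((∫ y, cosInner t (f y) ∂ν : ℝ) : ℂ) + ((∫ y, sinInner t (f y) ∂ν : ℝ) : ℂ) * Complex.I := by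
  have hc : Integrable (fun y => ((cosInner t (f y) : ℝ) : ℂ)) ν :=
    (Integrable.of_bound ((cosInner t).continuous.measurable.comp hf).aestronglyMeasurable 1
      (ae_of_all _ fun y => Real.abs_cos_le_one _)).ofReal
  have hs : Integrable (fun y => ((sinInner t (f y) : ℝ) : ℂ) * Complex.I) ν :=
    (Integrable.of_bound ((sinInner t).continuous.measurable.comp hf).aestronglyMeasurable 1
      (ae_of_all _ fun y => Real.abs_sin_le_one _)).ofReal.mul_const _
  rw [← integral_complex_ofReal, ← integral_complex_ofReal, ← integral_mul_const,
    ← integral_add hc hs]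
  congr 1 with y
  rw [Complex.exp_mul_I]
  simp [cosInner, sinInner]

/-- If `X n` converges in distribution to a standard Gaussian and, conditionally, `Y n` converges
in distribution to a standard Gaussian, in probability, then `X n` and conditionally independent
copies of `Y n` converge jointly to independent standard Gaussians. -/
theorem tendstoInDistribution_of_conditional {Obs Mis : ℕ → Type*}
    {mO : ∀ n, MeasurableSpace (Obs n)} {mM : ∀ n, MeasurableSpace (Mis n)}
    {μ : ∀ n, Measure (Obs n)} [∀ n, IsProbabilityMeasure (μ n)]
    {κ : ∀ n, Kernel (Obs n) (Mis n)} [∀ n, IsMarkovKernel (κ n)] (m : ℕ)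
    {X : ∀ n, Obs n → E} {Y : ∀ n, Obs n × Mis n → E}
    (hXm : ∀ n, Measurable (X n)) (hYm : ∀ n, Measurable (Y n))
    (hX : TendstoInDistribution X atTop (fun z : E => z) μ (stdGaussian E))
    (hY : ∀ g : E →ᵇ ℝ, ∀ ε > 0, Tendsto (fun n => μ n {o | ε ≤
      |(∫ y, g (Y n (o, y)) ∂(κ n o)) - ∫ z, g z ∂(stdGaussian E)|}) atTop (𝓝 0)) :
    TendstoInDistribution
      (fun n (ω : Obs n × (Fin m → Mis n)) => (WithLp.toLp 2 fun i : Option (Fin m) =>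
        i.elim (X n ω.1) fun ℓ => Y n (ω.1, ω.2 ℓ) : PiLp 2 fun _ : Option (Fin m) => E))
      atTop (fun z => z) (fun n => μ n ⊗ₘ iidKernel m (κ n))
      (stdGaussian (PiLp 2 fun _ : Option (Fin m) => E)) := by
  set Zf := fun n (ω : Obs n × (Fin m → Mis n)) => (WithLp.toLp 2 fun i : Option (Fin m) =>
        i.elim (X n ω.1) fun ℓ => Y n (ω.1, ω.2 ℓ) : PiLp 2 fun _ : Option (Fin m) => E) with hZf
  have hZm : ∀ n, Measurable (Zf n) := fun n => by
    refine (WithLp.measurable_toLp 2 _).comp (measurable_pi_lambda _ fun i => ?_)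
    cases i with
    | none => exact (hXm n).comp measurable_fst
    | some ℓ =>
      exact (hYm n).comp (measurable_fst.prodMk ((measurable_pi_apply ℓ).comp measurable_snd))
  refine ⟨fun n => (hZm n).aemeasurable, aemeasurable_id, ?_⟩
  refine ProbabilityMeasure.tendsto_of_tendsto_charFun fun t => ?_
  set e : E → E → ℂ := fun x s => Complex.exp (inner ℝ x s * Complex.I) with he
  have he1 : ∀ x s, ‖e x s‖ = 1 := fun x s => Complex.norm_exp_ofReal_mul_I _
  set c : ∀ n, Obs n → E → ℂ := fun n o s => ∫ y, e (Y n (o, y)) s ∂(κ n o) with hc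
  set c0 : E → ℂ := fun s => charFun (stdGaussian E) s with hc0
  have hc1 : ∀ n o s, ‖c n o s‖ ≤ 1 := fun n o s => by
    refine (norm_integral_le_integral_norm _).trans ?_
    simp [he1]
  have hc01 : ∀ s, ‖c0 s‖ ≤ 1 := fun s => norm_charFun_le_one _
  have hem : ∀ s, Continuous fun x => e x s := fun s => by simp only [he]; fun_prop
  have hcm : ∀ n s, Measurable fun o => c n o s := fun n s =>
    (StronglyMeasurable.integral_kernel_prod_right' (κ := κ n)
      (((hem s).measurable.comp (hYm n)).stronglyMeasurable)).measurable
  -- The conditional characteristic functions converge in mean.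
  have hmean : ∀ s, Tendsto (fun n => ∫ o, ‖c n o s - c0 s‖ ∂μ n) atTop (𝓝 0) := by
    intro s
    refine tendsto_integral_zero_of_tendsto_measure (C := 2)
      (fun n => ((hcm n s).sub measurable_const).norm) (fun _ _ => norm_nonneg _)
      (fun n o => (norm_sub_le _ _).trans (by linarith [hc1 n o s, hc01 s])) fun ε hε => ?_
    have h1 := hY (cosInner s) (ε / 2) (by positivity)
    have h2 := hY (sinInner s) (ε / 2) (by positivity)
    refine tendsto_of_tendsto_of_tendsto_of_le_of_le tendsto_const_nhds (by simpa using h1.add h2)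
        (fun _ => bot_le) fun n => ?_
    refine (measure_mono fun o ho => ?_).trans (measure_union_le _ _)
    by_contra hcon
    simp only [Set.mem_union, Set.mem_ofPred_eq, not_or, not_le] at hcon ho
    have hcn := integral_exp_inner_eq (κ n o) (f := fun y => Y n (o, y))
      ((hYm n).comp measurable_prodMk_left) s
    have hcn0 := integral_exp_inner_eq (stdGaussian E) (f := fun y => y) measurable_id s
    have heq : c n o s - c0 s = (((∫ y, cosInner s (Y n (o, y)) ∂(κ n o))
        - ∫ z, cosInner s z ∂(stdGaussian E) : ℝ) : ℂ) + (((∫ y, sinInner s (Y n (o, y)) ∂(κ n o))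
        - ∫ z, sinInner s z ∂(stdGaussian E) : ℝ) : ℂ) * Complex.I := by
      simp only [hc, hc0, he, charFun_apply]
      rw [hcn, hcn0]; push_cast; ring
    rw [heq] at ho
    have h3 := ho.trans (norm_add_le _ _)
    rw [norm_mul, Complex.norm_I, mul_one, Complex.norm_real, Complex.norm_real,
      Real.norm_eq_abs, Real.norm_eq_abs] at h3
    linarith [hcon.1, hcon.2]
  -- Given `o`, the factor of `X n` is constant and the copies of `Y n` are independent, so the
  -- conditional characteristic function is a product.
  have hform : ∀ n, charFun ((μ n ⊗ₘ iidKernel m (κ n)).map (Zf n)) t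
      = ∫ o, e (X n o) (t none) * ∏ ℓ, c n o (t (some ℓ)) ∂μ n := fun n => by
    rw [charFun_apply, integral_map (hZm n).aemeasurable
      (by fun_prop), Measure.integral_compProd]
    · congr 1 with o
      simp only [hZf, PiLp.inner_apply, Fintype.sum_option, Option.elim]
      push_cast
      simp_rw [add_mul, Complex.exp_add, Finset.sum_mul, Complex.exp_sum]
      rw [integral_const_mul]
      congr 1
      exact integral_fintype_prod_eq_prod (𝕜 := ℂ) (μ := fun _ : Fin m => κ n o)
        (fun ℓ y => e (Y n (o, y)) (t (some ℓ)))
    · refine Integrable.of_bound (C := 1) ?_ (ae_of_all _ fun ω => ?_)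
      · have h1 : Continuous fun z : PiLp 2 fun _ : Option (Fin m) => E =>
          Complex.exp (inner ℝ z t * Complex.I) := by fun_prop
        exact (h1.measurable.comp (hZm n)).aestronglyMeasurable
      · exact (Complex.norm_exp_ofReal_mul_I _).le
  have hlim : charFun (stdGaussian (PiLp 2 fun _ : Option (Fin m) => E)) t
      = c0 (t none) * ∏ ℓ, c0 (t (some ℓ)) := by
    simp only [hc0, charFun_stdGaussian]
    rw [← Complex.ofReal_pow, PiLp.norm_sq_eq_of_L2, Fintype.sum_option, ← Complex.exp_sum, ← Complex.exp_add]
    congr 1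
    push_cast
    rw [neg_add, add_div, ← Finset.sum_div, Finset.sum_neg_distrib]
  have hXc : Tendsto (fun n => ∫ o, e (X n o) (t none) ∂μ n) atTop (𝓝 (c0 (t none))) := by
    have := (ProbabilityMeasure.tendsto_iff_tendsto_charFun.1 hX.tendsto) (t none)
    convert this using 2 with n
    · simp only [ProbabilityMeasure.coe_mk]
      rw [charFun_apply, integral_map (hXm n).aemeasurable (by fun_prop)]
    · simp [hc0]
  -- As `|e| = 1`, replacing each `c n o` by the constant `c0` costs at most the sum of the mean
  -- errors `hmean`. With constants in place only the law of `X n` matters, which is why the limits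
  -- are independent.
  have hlast : Tendsto (fun n => ∫ o, e (X n o) (t none) * ∏ ℓ, c n o (t (some ℓ)) ∂μ n) atTop
      (𝓝 (c0 (t none) * ∏ ℓ, c0 (t (some ℓ)))) := by
    have hmain := hXc.mul_const (∏ ℓ, c0 (t (some ℓ)))
    refine tendsto_of_tendsto_of_dist hmain ?_
    have hsum : Tendsto (fun n => ∑ ℓ, ∫ o, ‖c n o (t (some ℓ)) - c0 (t (some ℓ))‖ ∂μ n) atTop
        (𝓝 0) := by
      simpa using tendsto_finsetSum Finset.univ fun ℓ _ => hmean (t (some ℓ))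
    refine squeeze_zero (fun _ => dist_nonneg) (fun n => ?_) hsum
    have hpm : Measurable fun o => ∏ ℓ, c n o (t (some ℓ)) :=
      Finset.measurable_prod _ fun ℓ _ => hcm n _
    have hpb : ∀ o, ‖∏ ℓ, c n o (t (some ℓ))‖ ≤ 1 := fun o => by
      rw [norm_prod]; exact Finset.prod_le_one (fun _ _ => norm_nonneg _) fun j _ => hc1 _ _ _
    have hXem : Measurable fun o => e (X n o) (t none) := (hem _).measurable.comp (hXm n)
    have hnm : ∀ s, Measurable fun o => ‖c n o s - c0 s‖ := fun s =>
      ((hcm n s).sub measurable_const).norm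
    rw [dist_comm, dist_eq_norm, ← integral_mul_const, ← integral_sub, ← integral_finsetSum]
    · refine norm_integral_le_of_norm_le ?_ (ae_of_all _ fun o => ?_)
      · exact integrable_finsetSum _ fun ℓ _ => Integrable.of_bound
          (hnm _).aestronglyMeasurable 2 (ae_of_all _ fun o => by
            rw [norm_norm]
            exact (norm_sub_le _ _).trans (by linarith [hc1 n o (t (some ℓ)), hc01 (t (some ℓ))]))
      · rw [← mul_sub, norm_mul, he1, one_mul]
        exact norm_prod_sub_prod_le _ (fun _ => hc1 _ _ _) fun _ => hc01 _
    · intro ℓ _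
      exact Integrable.of_bound
          (hnm _).aestronglyMeasurable 2 (ae_of_all _ fun o => by
            rw [norm_norm]
            exact (norm_sub_le _ _).trans (by linarith [hc1 n o (t (some ℓ)), hc01 (t (some ℓ))]))
    · refine Integrable.of_bound (hXem.mul hpm).aestronglyMeasurable 1 (ae_of_all _ fun o => ?_)
      rw [norm_mul, he1, one_mul]; exact hpb o
    · refine (Integrable.of_bound hXem.aestronglyMeasurable 1 (ae_of_all _ fun o => ?_)).mul_const _
      rw [he1]
  simp only [ProbabilityMeasure.coe_mk]
  simp_rw [hform]
  have hid : (stdGaussian (PiLp 2 fun _ : Option (Fin m) => E)).map (fun z => z)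
    = stdGaussian (PiLp 2 fun _ : Option (Fin m) => E) := Measure.map_id
  rw [hid, hlim]
  exact hlast

end ConditionalConvergence

/-! ### Projections of standard Gaussian vectors: chi-squared laws and independence -/

section Gaussian

variable {E F : Type*} [NormedAddCommGroup E] [InnerProductSpace ℝ E] [FiniteDimensional ℝ E]
  [MeasurableSpace E] [BorelSpace E] [NormedAddCommGroup F] [InnerProductSpace ℝ F]
  [FiniteDimensional ℝ F] [MeasurableSpace F] [BorelSpace F]

/-- A linear map whose adjoint is isometric maps the standard Gaussian to the standard Gaussian. -/
theorem stdGaussian_map_of_adjoint_isometry {A : E →L[ℝ] F} {A' : F → E}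
    (hadj : ∀ x y, inner ℝ (A x) y = inner ℝ x (A' y)) (hA' : ∀ y, ‖A' y‖ = ‖y‖) :
    (stdGaussian E).map A = stdGaussian F := by
  have := Measure.isProbabilityMeasure_map (μ := stdGaussian E) A.continuous.measurable.aemeasurable
  refine Measure.ext_of_charFun (funext fun t => ?_)
  rw [charFun_apply, integral_map A.continuous.measurable.aemeasurable (by fun_prop)]
  simp_rw [hadj]
  rw [← charFun_apply, charFun_stdGaussian, charFun_stdGaussian, hA']

theorem chiSquaredOver_eq_map_stdGaussian (d : ℕ) :
    chiSquaredOver d = (stdGaussian (EuclideanSpace ℝ (Fin d))).map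
      (fun x => ‖x‖ ^ 2 / (d : ℝ)) := by
  rw [← map_pi_eq_stdGaussian, Measure.map_map (by fun_prop) (by fun_prop), chiSquaredOver]
  congr 1
  funext z
  simp [EuclideanSpace.real_norm_sq_eq]

/-- The squared length of the projection of a standard Gaussian vector to a subspace has a
chi-squared law. -/
theorem map_stdGaussian_norm_sq_starProjection (U : Submodule ℝ E) {d : ℕ}
    (hd : Module.finrank ℝ U = d) :
    (stdGaussian E).map (fun x => ‖U.starProjection x‖ ^ 2 / (d : ℝ)) = chiSquaredOver d := by
  let b : OrthonormalBasis (Fin d) ℝ U := (stdOrthonormalBasis ℝ U).reindex (finCongr hd)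
  let A : E →L[ℝ] EuclideanSpace ℝ (Fin d) :=
    b.repr.toContinuousLinearEquiv.toContinuousLinearMap ∘L U.orthogonalProjectionOnto
  have hA : ∀ x, A x = b.repr (U.orthogonalProjectionOnto x) := fun _ => rfl
  have hmap : (stdGaussian E).map A = stdGaussian (EuclideanSpace ℝ (Fin d)) := by
    refine stdGaussian_map_of_adjoint_isometry (A' := fun y => (b.repr.symm y : E)) (fun x y => ?_)
      fun y => ?_
    · rw [hA, ← b.repr.apply_symm_apply y, b.repr.inner_map_map, b.repr.symm_apply_apply,
        Submodule.inner_orthogonalProjectionOnto_eq_of_mem_right]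
    · exact b.repr.symm.norm_map y
  rw [chiSquaredOver_eq_map_stdGaussian, ← hmap,
    Measure.map_map (by fun_prop) A.continuous.measurable]
  congr 1
  funext x
  simp only [Function.comp_apply, hA, LinearIsometryEquiv.norm_map]
  rfl

/-- Two linear images of a standard Gaussian vector are independent if the composition of one with
the adjoint of the other vanishes. -/
theorem indepFun_stdGaussian_of_adjoint {E₁ E₂ : Type*} [NormedAddCommGroup E₁]
    [InnerProductSpace ℝ E₁] [FiniteDimensional ℝ E₁] [MeasurableSpace E₁] [BorelSpace E₁]
    [NormedAddCommGroup E₂] [InnerProductSpace ℝ E₂] [FiniteDimensional ℝ E₂] [MeasurableSpace E₂]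
    [BorelSpace E₂] (A : E →L[ℝ] E₁) (B : E →L[ℝ] E₂) {A' : E₁ → E} {B' : E₂ → E}
    (hA : ∀ x y, inner ℝ (A x) y = inner ℝ x (A' y))
    (hB : ∀ x y, inner ℝ (B x) y = inner ℝ x (B' y))
    (h : ∀ x y, inner ℝ (A' x) (B' y) = 0) :
    IndepFun A B (stdGaussian E) := by
  have hid : HasGaussianLaw (fun x : E => x) (stdGaussian E) :=
    ⟨by simpa using (inferInstance : IsGaussian (stdGaussian E))⟩
  have hG : HasGaussianLaw (fun x : E => (A x, B x)) (stdGaussian E) := hid.map_fun (A.prod B)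
  -- Jointly Gaussian vectors are independent once uncorrelated, and the covariance of `⟪A ·, x⟫`
  -- and `⟪B ·, y⟫` is `⟪A' x, B' y⟫`.
  refine hG.indepFun_of_covariance_inner fun x y => ?_
  have h1 := covarianceBilin_apply_eq_cov (μ := stdGaussian E) IsGaussian.memLp_two_id
    (A' x) (B' y)
  rw [covarianceBilin_stdGaussian, innerSL_apply_apply, h] at h1
  rw [h1]
  congr 1 <;> funext z
  · rw [real_inner_comm, hA, real_inner_comm]
  · rw [real_inner_comm, hB, real_inner_comm]

end Gaussian

/-! ### Means and deviations in an array of vectors -/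

section Combinations

variable {E : Type*} [NormedAddCommGroup E] [InnerProductSpace ℝ E] {m : ℕ}

/-- The linear combination `∑ i, c i • w i` of the components of a vector of vectors. -/
noncomputable def combine {ι : Type*} [Fintype ι] (c : ι → ℝ) : (PiLp 2 fun _ : ι => E) →L[ℝ] E :=
  ∑ i, c i • PiLp.proj 2 (fun _ : ι => E) i

theorem combine_apply {ι : Type*} [Fintype ι] (c : ι → ℝ) (w : PiLp 2 fun _ : ι => E) :
    combine c w = ∑ i, c i • w i := by
  simp [combine]

theorem inner_combine {ι : Type*} [Fintype ι] (c : ι → ℝ) (w : PiLp 2 fun _ : ι => E) (v : E) :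
    inner ℝ (combine c w) v = inner ℝ w (WithLp.toLp 2 fun i => c i • v) := by
  simp [combine_apply, PiLp.inner_apply, sum_inner, real_inner_smul_left, real_inner_smul_right]

/-- By `inner_combine` this map is the adjoint of `combine c`; being isometric, it makes `combine c`
preserve standard Gaussians. -/
theorem norm_toLp_smul {ι : Type*} [Fintype ι] {c : ι → ℝ} (hc : ∑ i, c i ^ 2 = 1) (v : E) :
    ‖(WithLp.toLp 2 fun i => c i • v : PiLp 2 fun _ : ι => E)‖ = ‖v‖ := by
  rw [← sq_eq_sq₀ (norm_nonneg _) (norm_nonneg _), PiLp.norm_sq_eq_of_L2]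
  simp [norm_smul, mul_pow, ← Finset.sum_mul, hc]

variable (E m) in
/-- The families `(w₀, w₁, …, w_m)` of vectors with `w₀ = 0` and `w₁ + ⋯ + w_m = 0`. -/
def centeredSubspace : Submodule ℝ (PiLp 2 fun _ : Option (Fin m) => E) where
  carrier := {w | w none = 0 ∧ ∑ ℓ, w (some ℓ) = 0}
  add_mem' := by
    rintro a b ⟨ha, ha'⟩ ⟨hb, hb'⟩
    simp [ha, hb, Finset.sum_add_distrib, ha', hb']
  zero_mem' := by simp
  smul_mem' := by
    rintro c a ⟨ha, ha'⟩
    simp [ha, ← Finset.smul_sum, ha']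

theorem mem_centeredSubspace {w : PiLp 2 fun _ : Option (Fin m) => E} :
    w ∈ centeredSubspace E m ↔ w none = 0 ∧ ∑ ℓ, w (some ℓ) = 0 := Iff.rfl

variable [FiniteDimensional ℝ E]

/-- The subspace is the kernel of the surjection `w ↦ (w₀, ∑ w_ℓ)` onto `E × E`, so two of the `m +
1` copies of `E` are lost. This gives the degrees of freedom of `M₃`. -/
theorem finrank_centeredSubspace (hm : 0 < m) :
    Module.finrank ℝ (centeredSubspace E m) = Module.finrank ℝ E * (m - 1) := by
  let Φ : (PiLp 2 fun _ : Option (Fin m) => E) →ₗ[ℝ] E × E :=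
    { toFun := fun w => (w none, ∑ ℓ, w (some ℓ))
      map_add' := fun a b => by simp [Finset.sum_add_distrib]
      map_smul' := fun c a => by simp [Finset.smul_sum] }
  have hker : Φ.ker = centeredSubspace E m := by
    ext w
    simp [Φ, mem_centeredSubspace]
  have hsurj : Function.Surjective Φ := by
    rintro ⟨a, b⟩
    refine ⟨WithLp.toLp 2 fun i => i.elim a fun ℓ => if ℓ = ⟨0, hm⟩ then b else 0, ?_⟩
    simp [Φ]
  have h := LinearMap.finrank_range_add_finrank_ker Φ
  rw [hker, LinearMap.range_eq_top.2 hsurj, finrank_top, Module.finrank_prod,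
    (WithLp.linearEquiv 2 ℝ (Option (Fin m) → E)).finrank_eq, Module.finrank_pi_fintype] at h
  simp at h
  obtain ⟨d, rfl⟩ := Nat.exists_eq_add_of_lt hm
  simp only [zero_add, Nat.add_sub_cancel]
  nlinarith

/-- The remainder has the same vector, the mean, in every place `ℓ`, so it is orthogonal to families
with zero entry at `none` and zero sum. -/
theorem centeredSubspace_starProjection_apply (hm : 0 < m)
    (w : PiLp 2 fun _ : Option (Fin m) => E) :
    (centeredSubspace E m).starProjection w = WithLp.toLp 2 fun i : Option (Fin m) =>
      i.elim 0 fun ℓ => w (some ℓ) - avgVec fun ℓ => w (some ℓ) := by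
  refine (Submodule.eq_starProjection_of_mem_orthogonal ?_ ?_)
  · exact mem_centeredSubspace.2 ⟨rfl, sum_sub_avgVec hm _⟩
  · rw [Submodule.mem_orthogonal]
    intro u hu
    obtain ⟨hu1, hu2⟩ := mem_centeredSubspace.1 hu
    simp [PiLp.inner_apply, Fintype.sum_option, hu1, ← sum_inner, hu2]

theorem norm_sq_centeredSubspace_starProjection (hm : 0 < m)
    (w : PiLp 2 fun _ : Option (Fin m) => E) :
    ‖(centeredSubspace E m).starProjection w‖ ^ 2 = m * avgVar fun ℓ => w (some ℓ) := by
  have : (m : ℝ) ≠ 0 := by positivity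
  rw [centeredSubspace_starProjection_apply hm, PiLp.norm_sq_eq_of_L2, Fintype.sum_option, avgVar]
  simp [this]

/-- A combination that weighs `w₁, …, w_m` equally is independent of their deviations from the
mean. -/
theorem indepFun_centeredSubspace_combine [MeasurableSpace E] [BorelSpace E]
    {c : Option (Fin m) → ℝ} {s : ℝ} (hc : ∀ ℓ, c (some ℓ) = s) :
    IndepFun (centeredSubspace E m).starProjection (combine c)
      (stdGaussian (PiLp 2 fun _ : Option (Fin m) => E)) := by
  refine indepFun_stdGaussian_of_adjoint _ _
    (fun x y => Submodule.inner_starProjection_left_eq_right _ x y) (inner_combine c) fun x y => ?_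
  obtain ⟨h1, h2⟩ := mem_centeredSubspace.1 ((centeredSubspace E m).starProjection_apply_mem x)
  simp only [PiLp.inner_apply, Fintype.sum_option, hc, h1, real_inner_smul_right,
    ← Finset.mul_sum, ← sum_inner, h2]
  simp

end Combinations

/-! ### Square roots and perturbation of the information matrix -/

section Matrices

variable {h : ℕ} {J : Matrix (Fin h) (Fin h) ℝ}

/-- The linear map `J ^ (1/2)`. -/
noncomputable def sqrtCLM (J : Matrix (Fin h) (Fin h) ℝ) :
    EuclideanSpace ℝ (Fin h) →L[ℝ] EuclideanSpace ℝ (Fin h) :=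
  Matrix.toEuclideanCLM (𝕜 := ℝ) (CFC.sqrt J)

theorem inner_matVec_eq_norm_sq_sqrtCLM (hJ : J.PosDef) (v : EuclideanSpace ℝ (Fin h)) :
    inner ℝ v (matVec J v) = ‖sqrtCLM J v‖ ^ 2 := by
  have h1 : CFC.sqrt J * CFC.sqrt J = J := CFC.sqrt_mul_sqrt_self J hJ.posSemidef.nonneg
  have h2 : IsSelfAdjoint (CFC.sqrt J) := (CFC.sqrt_nonneg J).isSelfAdjoint
  have h3 : star (sqrtCLM J) = sqrtCLM J := by
    rw [sqrtCLM, ← map_star, h2.star_eq]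
  have h4 : matVec J v = sqrtCLM J (sqrtCLM J v) := by
    conv_lhs => rw [matVec, ← h1, map_mul]
    rfl
  rw [h4, ← real_inner_self_eq_norm_sq]
  conv_rhs => rw [← h3, ContinuousLinearMap.star_eq_adjoint,
    ContinuousLinearMap.adjoint_inner_left, ← ContinuousLinearMap.star_eq_adjoint, h3]

theorem sqrtCLM_injective (hJ : J.PosDef) : Function.Injective (sqrtCLM J) := by
  rw [injective_iff_map_eq_zero]
  intro v hv
  by_contra hne
  have h1 := inner_matVec_eq_norm_sq_sqrtCLM hJ v
  rw [hv, matVec, Matrix.inner_toEuclideanCLM] at h1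
  have h2 := hJ.dotProduct_mulVec_pos (x := v.ofLp) (by
    intro h; exact hne (by ext i; simpa using congrFun h i))
  simp at h1 h2
  linarith

/-- The linear equivalence `J ^ (1/2)`. -/
noncomputable def sqrtEquiv (hJ : J.PosDef) :
    EuclideanSpace ℝ (Fin h) ≃L[ℝ] EuclideanSpace ℝ (Fin h) :=
  (LinearEquiv.ofInjectiveEndo (sqrtCLM J).toLinearMap
    (sqrtCLM_injective hJ)).toContinuousLinearEquiv

theorem sqrtEquiv_apply (hJ : J.PosDef) (v : EuclideanSpace ℝ (Fin h)) :
    sqrtEquiv hJ v = sqrtCLM J v := rfl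

theorem inv_smul_inv_smul (hJ : J.PosDef) {N a : ℝ} (hN : 0 < N) (ha : 0 < a) :
    (a • (N • J)⁻¹)⁻¹ = (N / a) • J := by
  have hdet : IsUnit J.det := hJ.det_pos.ne'.isUnit
  refine Matrix.inv_eq_left_inv ?_
  rw [Matrix.smul_mul, Matrix.mul_smul, smul_smul]
  have : J * (N • J)⁻¹ = N⁻¹ • 1 := by
    have h2 : IsUnit (N • J).det := by
      rw [Matrix.det_smul]; exact (mul_pos (pow_pos hN _) hJ.det_pos).ne'.isUnit
    have h3 := Matrix.mul_nonsing_inv _ h2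
    rw [Matrix.smul_mul] at h3
    rw [← h3, smul_smul, inv_mul_cancel₀ hN.ne', one_smul]
  rw [this, smul_smul]
  convert one_smul ℝ _
  field_simp

theorem sqrt_smul_of_posDef (hJ : J.PosDef) {a : ℝ} (ha : 0 ≤ a) :
    CFC.sqrt (a • J) = √a • CFC.sqrt J := by
  have h1 : CFC.sqrt J * CFC.sqrt J = J := CFC.sqrt_mul_sqrt_self J hJ.posSemidef.nonneg
  refine CFC.sqrt_unique ?_ (smul_nonneg (Real.sqrt_nonneg a) (CFC.sqrt_nonneg J))
  rw [Matrix.smul_mul, Matrix.mul_smul, smul_smul, Real.mul_self_sqrt ha, h1]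

/-- Used with `a = 1 + r` for `𝒯` and `a = r` for `𝓑`: both standardizations are scalar multiples of
`J ^ (1/2)`. -/
theorem matVec_invSqrt (hJ : J.PosDef) {N a : ℝ} (hN : 0 < N) (ha : 0 < a)
    (v : EuclideanSpace ℝ (Fin h)) :
    matVec (invSqrt (a • (N • J)⁻¹)) v = √(N / a) • sqrtCLM J v := by
  rw [matVec, invSqrt, inv_smul_inv_smul hJ hN ha, sqrt_smul_of_posDef hJ (by positivity), sqrtCLM,
    map_smul]
  rfl

/-- Entrywise smallness controls the operator norm, since a linear map on a finite-dimensional space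
is continuous at zero. -/
theorem exists_forall_not_entryGE_norm_lt {η : ℝ} (hη : 0 < η) :
    ∃ ε > 0, ∀ X : Matrix (Fin h) (Fin h) ℝ, ¬EntryGE ε X →
      ‖Matrix.toEuclideanCLM (𝕜 := ℝ) X‖ < η := by
  have hcont : Continuous fun X : Fin h → Fin h → ℝ =>
      Matrix.toEuclideanCLM (𝕜 := ℝ) (Matrix.of X) :=
    LinearMap.continuous_of_finiteDimensional
      ((Matrix.toEuclideanCLM (n := Fin h) (𝕜 := ℝ)).toAlgEquiv.toLinearMap ∘ₗ
        (Matrix.ofLinearEquiv ℝ).toLinearMap)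
  have h0 : Matrix.toEuclideanCLM (𝕜 := ℝ) (Matrix.of (0 : Fin h → Fin h → ℝ)) = 0 := map_zero _
  obtain ⟨ε, hε, hb⟩ := Metric.continuous_iff.1 hcont 0 η hη
  refine ⟨ε, hε, fun X hX => ?_⟩
  have h1 : dist (Matrix.of.symm X) 0 < ε := by
    rw [dist_pi_lt_iff hε]
    intro i
    rw [dist_pi_lt_iff hε]
    intro j
    by_contra hc
    exact hX ⟨i, j, by simpa using hc⟩
  have h2 := hb _ h1
  rw [h0, dist_zero_right] at h2
  exact h2

/-- If `𝒯⁻¹ (A⁻¹ - 𝒰)` is small, then the quadratic form of `A` is close to that of `𝒰⁻¹`. -/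
theorem exists_forall_quadForm_close (hJ : J.PosDef) {r : ℝ} (hr : 0 < r) {ε : ℝ} (hε : 0 < ε) :
    ∃ ε' > 0, ∀ N : ℝ, 0 < N → ∀ A : Matrix (Fin h) (Fin h) ℝ,
      ¬EntryGE ε' (((1 + r) • (N • J)⁻¹)⁻¹ * (A⁻¹ - (N • J)⁻¹)) →
      ∀ v, |inner ℝ v (matVec A v) - N * ‖sqrtCLM J v‖ ^ 2| ≤ ε * (N * ‖sqrtCLM J v‖ ^ 2) := by
  obtain ⟨K, hK, hKb⟩ : ∃ K : ℝ, 0 < K ∧ ∀ v, ‖v‖ ≤ K * ‖sqrtCLM J v‖ := by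
    refine ⟨‖((sqrtEquiv hJ).symm : EuclideanSpace ℝ (Fin h) →L[ℝ] EuclideanSpace ℝ (Fin h))‖ + 1,
      by positivity, fun v => ?_⟩
    have := ((sqrtEquiv hJ).symm :
      EuclideanSpace ℝ (Fin h) →L[ℝ] EuclideanSpace ℝ (Fin h)).le_opNorm (sqrtCLM J v)
    rw [← sqrtEquiv_apply hJ, ContinuousLinearEquiv.coe_coe,
      ContinuousLinearEquiv.symm_apply_apply] at this
    rw [← sqrtEquiv_apply hJ]
    nlinarith [norm_nonneg (sqrtEquiv hJ v)]
  set 𝒥 := Matrix.toEuclideanCLM (𝕜 := ℝ) J with h𝒥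
  -- The bound `1 / 2` lets `‖A v‖` be absorbed, giving `‖A v‖ ≤ 2 N ‖𝒥‖ ‖v‖`; the other bound turns
  -- the resulting multiple of `η` into `ε`, with `K` comparing `‖v‖` to `‖J^(1/2) v‖`.
  set η := min (1 / 2) (ε / (2 * (‖𝒥‖ + 1) * K ^ 2)) with hη
  have hη0 : 0 < η := by positivity
  obtain ⟨ε', hε', hX⟩ := exists_forall_not_entryGE_norm_lt (h := h)
    (show 0 < η / (1 + r) by positivity)
  refine ⟨ε', hε', fun N hN A hA v => ?_⟩
  have hdet : IsUnit (N • J).det := by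
    rw [Matrix.det_smul]; exact (mul_pos (pow_pos hN _) hJ.det_pos).ne'.isUnit
  set X := ((1 + r) • (N • J)⁻¹)⁻¹ * (A⁻¹ - (N • J)⁻¹) with hXdef
  have hXn : ∀ w, ‖matVec ((1 + r) • X) w‖ ≤ η * ‖w‖ := fun w => by
    have h1 := (Matrix.toEuclideanCLM (𝕜 := ℝ) X).le_of_opNorm_le (hX _ hA).le w
    rw [matVec, map_smul, smul_apply, norm_smul,
      Real.norm_of_nonneg (by positivity)]
    calc (1 + r) * _ ≤ (1 + r) * (η / (1 + r) * ‖w‖) := by gcongr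
      _ = η * ‖w‖ := by field_simp
  -- Multiplied by `A` on the right, this is `N • J - A`, the difference to be estimated.
  have hXeq : (1 + r) • X = (N • J) * A⁻¹ - 1 := by
    rw [hXdef, inv_smul_inv_smul hJ hN (by positivity), Matrix.mul_sub, smul_sub,
      Matrix.smul_mul, Matrix.smul_mul, smul_smul, smul_smul, mul_div_cancel₀ _ (by positivity),
      ← Matrix.smul_mul, ← Matrix.smul_mul, Matrix.mul_nonsing_inv _ hdet]
  have hη1 : η ≤ 1 / 2 := min_le_left _ _
  have hη2 : η * (2 * (‖𝒥‖ + 1) * K ^ 2) ≤ ε := by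
    rw [← le_div_iff₀ (by positivity)]; exact min_le_right _ _
  by_cases hAu : IsUnit A.det
  · have hmul : ((1 + r) • X) * A = N • J - A := by
      rw [hXeq, Matrix.sub_mul, one_mul, Matrix.mul_assoc, Matrix.nonsing_inv_mul _ hAu,
        Matrix.mul_one]
    have hv : matVec ((1 + r) • X) (matVec A v) = N • 𝒥 v - matVec A v := by
      have h1 : matVec ((1 + r) • X) (matVec A v) = matVec (((1 + r) • X) * A) v := by
        simp only [matVec, map_mul]; rfl
      rw [h1, hmul, matVec, map_sub, map_smul]; rfl
    have hb := hXn (matVec A v)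
    rw [hv] at hb
    have hJv : ‖𝒥 v‖ ≤ ‖𝒥‖ * ‖v‖ := 𝒥.le_opNorm v
    have hAv : ‖matVec A v‖ ≤ 2 * (N * (‖𝒥‖ * ‖v‖)) := by
      have h1 : ‖matVec A v‖ ≤ ‖N • 𝒥 v‖ + ‖N • 𝒥 v - matVec A v‖ := by
        rw [norm_sub_rev]; simpa using norm_add_le (N • 𝒥 v) (matVec A v - N • 𝒥 v)
      rw [norm_smul, Real.norm_of_nonneg hN.le] at h1
      have h2 : N * ‖𝒥 v‖ ≤ N * (‖𝒥‖ * ‖v‖) := by gcongr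
      have h3 : η * ‖matVec A v‖ ≤ 1 / 2 * ‖matVec A v‖ := by gcongr
      linarith
    have heq : inner ℝ v (matVec A v) - N * ‖sqrtCLM J v‖ ^ 2
        = - inner ℝ v (N • 𝒥 v - matVec A v) := by
      rw [← inner_matVec_eq_norm_sq_sqrtCLM hJ, inner_sub_right, real_inner_smul_right]
      simp [matVec, h𝒥]
    rw [heq, abs_neg]
    calc |inner ℝ v (N • 𝒥 v - matVec A v)| ≤ ‖v‖ * ‖N • 𝒥 v - matVec A v‖ :=
          abs_real_inner_le_norm _ _
      _ ≤ ‖v‖ * (η * (2 * (N * ((‖𝒥‖ + 1) * ‖v‖)))) := by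
          gcongr
          refine hb.trans ?_
          gcongr
          refine hAv.trans ?_
          gcongr
          linarith
      _ = η * (2 * (‖𝒥‖ + 1)) * N * ‖v‖ ^ 2 := by ring
      _ ≤ η * (2 * (‖𝒥‖ + 1)) * N * (K * ‖sqrtCLM J v‖) ^ 2 := by gcongr; exact hKb v
      _ = η * (2 * (‖𝒥‖ + 1) * K ^ 2) * (N * ‖sqrtCLM J v‖ ^ 2) := by ring
      _ ≤ ε * (N * ‖sqrtCLM J v‖ ^ 2) := by gcongr
  -- A singular `A` has inverse `0` by convention, so `(1 + r) • X = -1`; with norm at most `1 / 2`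
  -- this forces `v = 0`.
  · have hA0 : A⁻¹ = 0 := Matrix.nonsing_inv_apply_not_isUnit A hAu
    have hb := hXn v
    rw [hXeq, hA0, Matrix.mul_zero, zero_sub, matVec, map_neg, map_one] at hb
    simp only [neg_apply, one_apply_eq_self, norm_neg] at hb
    have hv0 : v = 0 := by
      rw [← norm_eq_zero]
      nlinarith [norm_nonneg v]
    simp [hv0]

/-- Identifies the quadratic form of `info` with minus the second derivative of the log-likelihood
along a direction. -/
theorem inner_matVec_of_bilin (B : EuclideanSpace ℝ (Fin h) →L[ℝ] EuclideanSpace ℝ (Fin h) →L[ℝ] ℝ)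
    (v : EuclideanSpace ℝ (Fin h)) :
    inner ℝ v (matVec (Matrix.of fun i j =>
      -B (EuclideanSpace.single i 1) (EuclideanSpace.single j 1)) v) = -B v v := by
  have hv : v = ∑ i, v i • EuclideanSpace.single i (1 : ℝ) := by
    ext j; simp [Pi.single_apply]
  rw [matVec, Matrix.inner_toEuclideanCLM]
  conv_rhs => rw [hv]
  simp only [map_sum, map_smul, sum_apply, smul_apply,
    smul_eq_mul, dotProduct, Matrix.mulVec, Matrix.of_apply, Finset.mul_sum,
    ← Finset.sum_neg_distrib]
  refine Finset.sum_comm.trans (Finset.sum_congr rfl fun i _ => Finset.sum_congr rfl fun j _ => ?_)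
  ring

end Matrices

/-! ### Events of high probability on which the likelihood expansion holds -/

namespace MIModel

variable {h m : ℕ} {M : MIModel h}

/-- Each coordinate of the product kernel has the law of one imputation, so conditions on a single
completed data set pass to all `m`. -/
theorem measurePreserving_completed (n : ℕ) (ψ : M.Ψ) (ℓ : Fin m) :
    MeasurePreserving (fun ω : M.Obs n × (Fin m → M.Mis n) => M.completed ω ℓ)
      (M.miLaw m n ψ) (M.completedLaw n ψ) := by
  have hm : Measurable (fun ω : M.Obs n × (Fin m → M.Mis n) => M.completed ω ℓ) :=
    measurable_fst.prodMk ((measurable_pi_apply ℓ).comp measurable_snd)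
  refine ⟨hm, ?_⟩
  have hk : (iidKernel m (M.impute n)).map (fun y => y ℓ) = M.impute n := by
    ext1 o
    rw [Kernel.map_apply _ (measurable_pi_apply ℓ)]
    exact (measurePreserving_eval (fun _ : Fin m => M.impute n o) ℓ).map_eq
  rw [miLaw, completedLaw]
  conv_rhs => rw [← hk, Measure.compProd_map (measurable_pi_apply ℓ)]
  rfl

/-- Events that are unlikely for a completed data set are unlikely for all of them together. -/
theorem tendsto_miLaw_exists_completed (ψ : M.Ψ) {A : ∀ n, Set (M.Obs n × M.Mis n)}
    (hA : Tendsto (fun n => M.completedLaw n ψ (A n)) atTop (𝓝 0)) :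
    Tendsto (fun n => M.miLaw m n ψ {ω | ∃ ℓ, M.completed ω ℓ ∈ A n}) atTop (𝓝 0) := by
  have h1 : Tendsto (fun n => ∑ _ℓ : Fin m, M.completedLaw n ψ (A n)) atTop (𝓝 0) := by
    simpa using tendsto_finsetSum (Finset.univ : Finset (Fin m)) fun _ _ => hA
  refine tendsto_of_tendsto_of_tendsto_of_le_of_le tendsto_const_nhds h1 (fun _ => bot_le)
    fun n => ?_
  have heq : {ω : M.Obs n × (Fin m → M.Mis n) | ∃ ℓ, M.completed ω ℓ ∈ A n}
      = ⋃ ℓ : Fin m, (fun ω => M.completed ω ℓ) ⁻¹' A n := by ext; simp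
  simp only [heq]
  refine (measure_iUnion_fintype_le _ _).trans (Finset.sum_le_sum fun ℓ _ => ?_)
  have hp := measurePreserving_completed (m := m) n ψ ℓ
  rw [← hp.map_eq]
  exact Measure.le_map_apply hp.measurable.aemeasurable _

theorem ae_miLaw_forall_completed (n : ℕ) (ψ : M.Ψ) {P : M.Obs n × M.Mis n → Prop}
    (hP : ∀ᵐ x ∂M.completedLaw n ψ, P x) :
    ∀ᵐ ω ∂M.miLaw m n ψ, ∀ ℓ, P (M.completed ω ℓ) :=
  ae_all_iff.2 fun ℓ => (measurePreserving_completed n ψ ℓ).quasiMeasurePreserving.ae hP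

/-- The likelihood-based expansion at a data set holds with relative error `ε` in the ball of radius
`δ`, and the likelihood is smaller outside this ball than at its centre. -/
structure IsGood (est : M.Estimators m) (ψ : M.Ψ) (J : Matrix (Fin h) (Fin h) ℝ) (ε δ : ℝ) (n : ℕ)
    (ω : M.Obs n × (Fin m → M.Mis n)) : Prop where
  expansion : ∀ x ∈ Metric.ball (ψ : EuclideanSpace ℝ (Fin h)) δ, ∀ ℓ,
    |2 * (M.logLik n (M.completed ω ℓ) (est.complete n (M.completed ω ℓ))
        - M.logLik n (M.completed ω ℓ) x)
      - n * ‖sqrtCLM J (x - est.complete n (M.completed ω ℓ))‖ ^ 2|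
    ≤ ε * (n * ‖sqrtCLM J (x - est.complete n (M.completed ω ℓ))‖ ^ 2)
  separated : ∀ x ∈ M.Ψ, x ∉ Metric.ball (ψ : EuclideanSpace ℝ (Fin h)) δ → ∀ ℓ,
    M.logLik n (M.completed ω ℓ) x < M.logLik n (M.completed ω ℓ) ψ

variable {est : M.Estimators m} {ψ : M.Ψ} {J : Matrix (Fin h) (Fin h) ℝ}
  {T : ℕ → Matrix (Fin h) (Fin h) ℝ} {r : ℝ}

/-- The standardized estimators from the observed and the completed data. -/
noncomputable def stdEst (est : M.Estimators m) (ψ : M.Ψ) (J : Matrix (Fin h) (Fin h) ℝ)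
    (T : ℕ → Matrix (Fin h) (Fin h) ℝ) (n : ℕ) (ω : M.Obs n × (Fin m → M.Mis n)) :
    PiLp 2 fun _ : Option (Fin m) => EuclideanSpace ℝ (Fin h) :=
  WithLp.toLp 2 fun i : Option (Fin m) =>
    i.elim (matVec (invSqrt (T n)) (est.observed n ω.1 - ψ)) fun ℓ =>
      matVec (invSqrt (T n - ((n : ℝ) • J)⁻¹))
        (est.complete n (ω.1, ω.2 ℓ) - est.observed n ω.1)

theorem measurable_matVec (A : Matrix (Fin h) (Fin h) ℝ) : Measurable (matVec A) :=
  (Matrix.toEuclideanCLM (𝕜 := ℝ) A).continuous.measurable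

theorem measurable_stdEst (n : ℕ) : Measurable (stdEst est ψ J T n) := by
  refine (WithLp.measurable_toLp 2 _).comp (measurable_pi_lambda _ fun i => ?_)
  cases i with
  | none =>
    exact (measurable_matVec _).comp
      (((est.measurable_observed n).comp measurable_fst).sub measurable_const)
  | some ℓ =>
    exact (measurable_matVec _).comp (((est.measurable_complete n).comp
      (measurable_fst.prodMk ((measurable_pi_apply ℓ).comp measurable_snd))).sub
        ((est.measurable_observed n).comp measurable_fst))

theorem stdEst_tendstoInDistribution (hRC : RegularityConditions est ψ J T r) :
    TendstoInDistribution (stdEst est ψ J T) atTop (fun z => z) (fun n => M.miLaw m n ψ)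
      (stdGaussian (PiLp 2 fun _ : Option (Fin m) => EuclideanSpace ℝ (Fin h))) :=
  tendstoInDistribution_of_conditional m
    (X := fun n o => matVec (invSqrt (T n)) (est.observed n o - ψ))
    (Y := fun n x => matVec (invSqrt (T n - ((n : ℝ) • J)⁻¹))
      (est.complete n x - est.observed n x.1))
    (fun n => (measurable_matVec _).comp ((est.measurable_observed n).sub measurable_const))
    (fun n => (measurable_matVec _).comp ((est.measurable_complete n).sub
      ((est.measurable_observed n).comp measurable_fst)))
    hRC.observed_normal hRC.imputed_normal

/-- The vectors `(1 + r) ^ (1/2) w₀ + r ^ (1/2) w_ℓ`. -/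
noncomputable def shifted (r : ℝ) (w : PiLp 2 fun _ : Option (Fin m) => EuclideanSpace ℝ (Fin h)) (ℓ : Fin m) :
    EuclideanSpace ℝ (Fin h) :=
  √(1 + r) • w none + √r • w (some ℓ)

/-- Equal fractions of missing information give `𝒯 = (1 + r) 𝒰` and `𝓑 = r 𝒰`, so after rescaling
both terms carry the same factor `√n J^(1/2)` and `ψ̂_obs` cancels. -/
theorem shifted_stdEst (hRC : RegularityConditions est ψ J T r) {n : ℕ} (hn : 0 < n)
    (ω : M.Obs n × (Fin m → M.Mis n)) (ℓ : Fin m) :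
    shifted r (stdEst est ψ J T n ω) ℓ
      = √n • sqrtCLM J (est.complete n (M.completed ω ℓ) - ψ) := by
  have hr := hRC.r_pos
  have hn' : (0 : ℝ) < n := by exact_mod_cast hn
  have hB : T n - ((n : ℝ) • J)⁻¹ = r • ((n : ℝ) • J)⁻¹ := by
    rw [hRC.efmi n hn, add_smul, one_smul, add_sub_cancel_left]
  simp only [shifted, stdEst, Option.elim]
  rw [hB, hRC.efmi n hn, matVec_invSqrt hRC.posDef hn' (by positivity),
    matVec_invSqrt hRC.posDef hn' hr, smul_smul, smul_smul, ← Real.sqrt_mul (by positivity),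
    ← Real.sqrt_mul hr.le, mul_div_cancel₀ _ (by positivity), mul_div_cancel₀ _ hr.ne',
    ← smul_add, ← map_add]
  congr 2
  simp [completed]

theorem norm_shifted_le {R : ℝ} {w : PiLp 2 fun _ : Option (Fin m) => EuclideanSpace ℝ (Fin h)}
    (hw : ‖w‖ ≤ R) (ℓ : Fin m) : ‖shifted r w ℓ‖ ≤ (√(1 + r) + √r) * R := by
  have h1 : ∀ i, ‖w i‖ ≤ R := fun i => (PiLp.norm_apply_le w i).trans hw
  calc ‖shifted r w ℓ‖ ≤ ‖√(1 + r) • w none‖ + ‖√r • w (some ℓ)‖ := norm_add_le _ _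
    _ ≤ √(1 + r) * R + √r * R := by
        rw [norm_smul, norm_smul, Real.norm_of_nonneg (Real.sqrt_nonneg _),
          Real.norm_of_nonneg (Real.sqrt_nonneg _)]
        gcongr <;> exact h1 _
    _ = _ := by ring

/-- The score vanishes at the MLE `a`, and the closeness of the information to `n J`, applied in the
direction `b - a`, controls the Hessian on the whole ball. -/
theorem abs_expansion_le (hRC : RegularityConditions est ψ J T r) {ε ε' δ : ℝ}
    (hε' : ∀ N : ℝ, 0 < N → ∀ A : Matrix (Fin h) (Fin h) ℝ,
      ¬EntryGE ε' (((1 + r) • (N • J)⁻¹)⁻¹ * (A⁻¹ - (N • J)⁻¹)) →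
      ∀ v, |inner ℝ v (matVec A v) - N * ‖sqrtCLM J v‖ ^ 2| ≤ ε * (N * ‖sqrtCLM J v‖ ^ 2))
    (hball : Metric.ball (ψ : EuclideanSpace ℝ (Fin h)) δ ⊆ M.Ψ) {n : ℕ} (hn : 0 < n)
    {x : M.Obs n × M.Mis n} {a : EuclideanSpace ℝ (Fin h)} (hreg : IsRegularMLE n x a)
    (hinfo : ∀ ψ' ∈ M.Ψ, ‖ψ' - ψ‖ < δ →
      ¬EntryGE ε' ((T n)⁻¹ * ((M.info n x ψ')⁻¹ - ((n : ℝ) • J)⁻¹)))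
    (ha : a ∈ Metric.ball (ψ : EuclideanSpace ℝ (Fin h)) δ)
    {b : EuclideanSpace ℝ (Fin h)} (hb : b ∈ Metric.ball (ψ : EuclideanSpace ℝ (Fin h)) δ) :
    |2 * (M.logLik n x a - M.logLik n x b) - n * ‖sqrtCLM J (b - a)‖ ^ 2|
      ≤ ε * (n * ‖sqrtCLM J (b - a)‖ ^ 2) := by
  refine abs_two_mul_sub_sub_le_of_hessian_close Metric.isOpen_ball (convex_ball _ _)
    (hreg.contDiffOn.mono hball) ha hb ((hreg.score_eq_zero_iff a hreg.mem).2 rfl) fun y hy => ?_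
  have h1 := hinfo y (hball hy) (by simpa [dist_eq_norm] using hy)
  rw [hRC.efmi n hn] at h1
  have h2 := hε' n (by exact_mod_cast hn) _ h1 (b - a)
  rwa [info, inner_matVec_of_bilin] at h2

/-- When the standardized estimators are bounded by `R`, each `ψ̂^ℓ` is within order `n^(-1/2)` of
`ψ`, hence in the ball for large `n`. Goodness then fails only if the information or the separation
condition fails. -/
theorem tendsto_measure_not_isGood (hRC : RegularityConditions est ψ J T r) {ε δ₀ : ℝ}
    (hε : 0 < ε) (hδ₀ : 0 < δ₀) (R : ℝ) :
    ∃ δ > 0, δ ≤ δ₀ ∧ Metric.ball (ψ : EuclideanSpace ℝ (Fin h)) δ ⊆ M.Ψ ∧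
      Tendsto (fun n => M.miLaw m n ψ
        {ω | ‖stdEst est ψ J T n ω‖ ≤ R ∧ ¬IsGood est ψ J ε δ n ω}) atTop (𝓝 0) := by
  obtain ⟨ε', hε', hclose⟩ := exists_forall_quadForm_close hRC.posDef hRC.r_pos hε
  obtain ⟨δ₁, hδ₁, hinfo⟩ := hRC.imputed_info ε' hε'
  obtain ⟨δ₂, hδ₂, hball⟩ := Metric.isOpen_iff.1 M.isOpen_Ψ ψ ψ.2
  set δ := min δ₀ (min δ₁ δ₂) with hδ
  have hδ0 : 0 < δ := by positivity
  have hδball : Metric.ball (ψ : EuclideanSpace ℝ (Fin h)) δ ⊆ M.Ψ :=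
    (Metric.ball_subset_ball ((min_le_right _ _).trans (min_le_right _ _))).trans hball
  refine ⟨δ, hδ0, min_le_left _ _, hδball, ?_⟩
  -- The radius is fixed first, by the expansion; separation holds at any radius.
  obtain ⟨δ₃, hδ₃, hsep⟩ := hRC.separated δ hδ0
  have h1 := tendsto_miLaw_exists_completed (m := m) ψ hinfo
  have h2 := tendsto_miLaw_exists_completed (m := m) ψ hsep
  set c := ‖((sqrtEquiv hRC.posDef).symm :
    EuclideanSpace ℝ (Fin h) →L[ℝ] EuclideanSpace ℝ (Fin h))‖ with hc
  have hlarge : ∀ᶠ n : ℕ in atTop, c * ((√(1 + r) + √r) * R) < δ * √n := by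
    have : Tendsto (fun n : ℕ => δ * √(n : ℝ)) atTop atTop :=
      (Real.tendsto_sqrt_atTop.comp tendsto_natCast_atTop_atTop).const_mul_atTop hδ0
    exact this.eventually_gt_atTop _
  refine tendsto_of_tendsto_of_tendsto_of_le_of_le' tendsto_const_nhds
    (by simpa using h1.add h2) (Eventually.of_forall fun _ => bot_le) ?_
  filter_upwards [hlarge, hRC.regular_completed, eventually_gt_atTop 0] with n hnl hreg hn
  have hreg' := ae_miLaw_forall_completed (m := m) n ψ hreg
  have hn' : (0 : ℝ) < n := by exact_mod_cast hn
  refine (measure_mono_ae ?_).trans (measure_union_le _ _)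
  filter_upwards [hreg'] with ω hω hbad
  by_contra hcon
  have hcon' := not_or.1 hcon
  obtain ⟨hc1, hc2⟩ := hcon'
  refine hbad.2 ⟨fun x hx ℓ => ?_, fun x hx hxb ℓ => ?_⟩
  · refine abs_expansion_le hRC hclose hδball hn (hω ℓ) (fun ψ' hψ' hlt hE => hc1 ⟨ℓ, ψ', hψ',
      hlt.trans_le ((min_le_right _ _).trans (min_le_left _ _)), hE⟩) ?_ hx
    rw [Metric.mem_ball, dist_eq_norm]
    have h3 := norm_shifted_le (r := r) hbad.1 ℓ
    rw [shifted_stdEst hRC hn, norm_smul, Real.norm_of_nonneg (Real.sqrt_nonneg _)] at h3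
    set v := est.complete n (M.completed ω ℓ) - (ψ : EuclideanSpace ℝ (Fin h))
    have h4 : ‖v‖ ≤ c * ‖sqrtCLM J v‖ := by
      have := ((sqrtEquiv hRC.posDef).symm :
        EuclideanSpace ℝ (Fin h) →L[ℝ] EuclideanSpace ℝ (Fin h)).le_opNorm (sqrtCLM J v)
      rwa [← sqrtEquiv_apply hRC.posDef, ContinuousLinearEquiv.coe_coe,
        ContinuousLinearEquiv.symm_apply_apply] at this
    have hs : 0 < √(n : ℝ) := Real.sqrt_pos.2 hn'
    have hc0 : 0 ≤ c := norm_nonneg _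
    refine lt_of_mul_lt_mul_right (lt_of_le_of_lt ?_ hnl) hs.le
    calc ‖v‖ * √n ≤ c * ‖sqrtCLM J v‖ * √n := by gcongr
      _ = c * (√n * ‖sqrtCLM J v‖) := by ring
      _ ≤ _ := by gcongr
  · have h3 : ¬((n : ℝ)⁻¹ * M.logLik n (M.completed ω ℓ) ψ - δ₃
        < (n : ℝ)⁻¹ * M.logLik n (M.completed ω ℓ) x) := fun hlt =>
      hc2 ⟨ℓ, x, hx, by simpa [dist_eq_norm] using hxb, hlt⟩
    have h4 : (n : ℝ)⁻¹ * M.logLik n (M.completed ω ℓ) x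
        < (n : ℝ)⁻¹ * M.logLik n (M.completed ω ℓ) ψ := by linarith
    exact lt_of_mul_lt_mul_left h4 (by positivity)

end MIModel

/-! ### Tangent approximation in the coordinates of the information metric -/

section TangentSpace

variable {E F : Type*} [NormedAddCommGroup E] [NormedSpace ℝ E] [FiniteDimensional ℝ E]
  [NormedAddCommGroup F] [NormedSpace ℝ F] [FiniteDimensional ℝ F]

/-- In linearly transformed coordinates, a level set is close to its tangent space. -/
theorem exists_level_close_tangent {θ : E → F} {θ' : E →L[ℝ] F} {p : E}
    (hθ : HasStrictFDerivAt θ θ' p) (hsurj : Function.Surjective θ') (S : E ≃L[ℝ] E) {ε : ℝ}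
    (hε : 0 < ε) :
    ∃ δ > 0,
      (∀ x, ‖x - p‖ < δ → θ x = θ p →
        ∃ v ∈ (θ' ∘L (S.symm : E →L[ℝ] E)).ker, ‖S (x - p) - v‖ ≤ ε * ‖S (x - p)‖) ∧
      ∀ v ∈ (θ' ∘L (S.symm : E →L[ℝ] E)).ker, ‖v‖ < δ →
        ∃ x, θ x = θ p ∧ ‖S (x - p) - v‖ ≤ ε * ‖v‖ := by
  -- The constraint is rewritten in the coordinate `u = S (x - p)`, with base point `0`, where both
  -- approximations apply.
  have hg : HasStrictFDerivAt (fun u => p + S.symm u) (S.symm : E →L[ℝ] E) 0 :=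
    (S.symm : E →L[ℝ] E).hasStrictFDerivAt.const_add p
  have hθS : HasStrictFDerivAt (fun u => θ (p + S.symm u)) (θ' ∘L (S.symm : E →L[ℝ] E)) 0 := by
    refine HasStrictFDerivAt.comp (g := θ) (f := fun u => p + S.symm u) 0 ?_ hg
    simpa using hθ
  have hs : Function.Surjective (θ' ∘L (S.symm : E →L[ℝ] E)) := hsurj.comp S.symm.surjective
  obtain ⟨δ₁, hδ₁, h1⟩ := exists_forall_mem_level_close_tangent hθS.hasFDerivAt hs hε
  obtain ⟨δ₂, hδ₂, h2⟩ := exists_forall_tangent_close_level hθS hs hε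
  set c := ‖(S : E →L[ℝ] E)‖ + 1 with hc
  have hc0 : 0 < c := by positivity
  refine ⟨min (δ₁ / c) δ₂, by positivity, fun x hx hxp => ?_, fun v hv hvδ => ?_⟩
  · have h3 : ‖S (x - p)‖ < δ₁ := by
      have h4 := (S : E →L[ℝ] E).le_opNorm (x - p)
      have h5 : ‖x - p‖ * c < δ₁ := (lt_div_iff₀ hc0).1 (hx.trans_le (min_le_left _ _))
      rw [ContinuousLinearEquiv.coe_coe] at h4
      nlinarith [norm_nonneg (x - p)]
    simpa using h1 (S (x - p)) (by simpa using h3) (by simpa using hxp)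
  · obtain ⟨u, hu, hub⟩ := h2 v hv (hvδ.trans_le (min_le_right _ _))
    exact ⟨p + S.symm u, by simpa using hu, by simpa using hub⟩

end TangentSpace

/-! ### Asymptotics of the pooled and the constrained loss -/

namespace MIModel

variable {h m : ℕ} {M : MIModel h} {est : M.Estimators m} {ψ : M.Ψ}
  {J : Matrix (Fin h) (Fin h) ℝ} {T : ℕ → Matrix (Fin h) (Fin h) ℝ} {r : ℝ}

/-- Twice the loss of average log-likelihood at `x`, relative to the separate maximizers. -/
noncomputable def loss (est : M.Estimators m) (n : ℕ) (ω : M.Obs n × (Fin m → M.Mis n))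
    (x : EuclideanSpace ℝ (Fin h)) : ℝ :=
  avgLoss (fun ℓ => M.logLik n (M.completed ω ℓ))
    (fun ℓ => est.complete n (M.completed ω ℓ)) x

theorem loss_eq (n : ℕ) (ω : M.Obs n × (Fin m → M.Mis n)) (x : EuclideanSpace ℝ (Fin h)) :
    loss est n ω x = 2 * M.avgLogLik ω (fun ℓ => est.complete n (M.completed ω ℓ))
      - 2 * M.avgLogLik ω (fun _ => x) := by
  rw [loss, avgLoss, ← Finset.mul_sum, Finset.sum_sub_distrib, avgLogLik, avgLogLik]
  ring

theorem loss_le_of_isMaxOn {n : ℕ} {ω : M.Obs n × (Fin m → M.Mis n)}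
    {C : Set (EuclideanSpace ℝ (Fin h))} {x z : EuclideanSpace ℝ (Fin h)}
    (hmax : IsMaxOn (fun ψ' => M.avgLogLik ω (fun _ => ψ')) C x) (hz : z ∈ C) :
    loss est n ω x ≤ loss est n ω z := by
  rw [loss_eq, loss_eq]
  have : M.avgLogLik ω (fun _ => z) ≤ M.avgLogLik ω (fun _ => x) := hmax hz
  linarith

/-- Outside the ball every completed log-likelihood, hence their average, is below its value at `ψ`.
The set `C` is `Ψ` for the pooled maximizer and the level set for the constrained one. -/
theorem IsGood.mem_ball (hm : 0 < m) {ε δ : ℝ} {n : ℕ} {ω : M.Obs n × (Fin m → M.Mis n)}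
    (hg : IsGood est ψ J ε δ n ω) {C : Set (EuclideanSpace ℝ (Fin h))}
    {x : EuclideanSpace ℝ (Fin h)} (hx : x ∈ M.Ψ)
    (hmax : IsMaxOn (fun ψ' => M.avgLogLik ω (fun _ => ψ')) C x) (hψ : ↑ψ ∈ C) :
    x ∈ Metric.ball (ψ : EuclideanSpace ℝ (Fin h)) δ := by
  by_contra hxb
  have h1 : M.avgLogLik ω (fun _ => (ψ : EuclideanSpace ℝ (Fin h)))
      ≤ M.avgLogLik ω (fun _ => x) := hmax hψ
  have : M.avgLogLik ω (fun _ => x)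
      < M.avgLogLik ω (fun _ => (ψ : EuclideanSpace ℝ (Fin h))) := by
    have hm' : (0 : ℝ) < m := by exact_mod_cast hm
    unfold avgLogLik
    gcongr ?_ / _
    exact Finset.sum_lt_sum_of_nonempty ⟨⟨0, hm⟩, Finset.mem_univ _⟩
      fun ℓ _ => hg.separated x hx hxb ℓ
  linarith

theorem shifted_stdEst_eq (hRC : RegularityConditions est ψ J T r) {n : ℕ} (hn : 0 < n)
    (ω : M.Obs n × (Fin m → M.Mis n)) :
    (fun ℓ => √(n : ℝ) • sqrtCLM J (est.complete n (M.completed ω ℓ) - ψ))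
      = shifted r (stdEst est ψ J T n ω) :=
  funext fun ℓ => (shifted_stdEst hRC hn ω ℓ).symm

theorem norm_sqrtEquiv_symm_lt (hJ : J.PosDef) {n : ℕ} (hn : 0 < n) {R δ : ℝ}
    (hl : ‖((sqrtEquiv hJ).symm : EuclideanSpace ℝ (Fin h) →L[ℝ] EuclideanSpace ℝ (Fin h))‖ * R
      < δ * √n) {v : EuclideanSpace ℝ (Fin h)} (hv : ‖√(n : ℝ) • sqrtCLM J v‖ ≤ R) : ‖v‖ < δ := by
  have hs : 0 < √(n : ℝ) := Real.sqrt_pos.2 (by exact_mod_cast hn)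
  have := ((sqrtEquiv hJ).symm :
    EuclideanSpace ℝ (Fin h) →L[ℝ] EuclideanSpace ℝ (Fin h)).le_opNorm (√(n : ℝ) • sqrtCLM J v)
  rw [← sqrtEquiv_apply hJ, ← map_smul, ContinuousLinearEquiv.coe_coe,
    ContinuousLinearEquiv.symm_apply_apply, norm_smul, Real.norm_of_nonneg hs.le,
    map_smul, sqrtEquiv_apply] at this
  refine lt_of_mul_lt_mul_right (lt_of_le_of_lt ?_ hl) hs.le
  rw [mul_comm]
  exact this.trans (by gcongr)

theorem eventually_lt_mul_sqrt (a : ℝ) {δ : ℝ} (hδ : 0 < δ) :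
    ∀ᶠ n : ℕ in atTop, a < δ * √(n : ℝ) :=
  ((Real.tendsto_sqrt_atTop.comp tendsto_natCast_atTop_atTop).const_mul_atTop
    hδ).eventually_gt_atTop _

/-- The loss at the pooled maximizer is asymptotically the variance of the separate maximizers. -/
theorem tendsto_loss_pooled (hm : 0 < m) (hRC : RegularityConditions est ψ J T r) {η : ℝ}
    (hη : 0 < η) :
    Tendsto (fun n => M.miLaw m n ψ {ω | η ≤
      |loss est n ω (est.pooled n ω) - avgVar (shifted r (stdEst est ψ J T n ω))|}) atTop
      (𝓝 0) := by
  refine tendsto_measure_zero_of_tight (exists_forall_measure_norm_gt_le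
    (stdEst_tendstoInDistribution hRC) measurable_stdEst) fun R => ?_
  set R' := (√(1 + r) + √r) * R with hR'
  set ε := min 1 (η / (2 * (R' ^ 2 + 1))) with hε
  have hε0 : 0 < ε := by positivity
  have hεη : ε * R' ^ 2 < η := by
    have : ε * (2 * (R' ^ 2 + 1)) ≤ η := (le_div_iff₀ (by positivity)).1 (min_le_right _ _)
    nlinarith [sq_nonneg R']
  obtain ⟨δ, hδ, -, hball, hgood⟩ := tendsto_measure_not_isGood hRC hε0 one_pos R
  refine tendsto_of_tendsto_of_tendsto_of_le_of_le' tendsto_const_nhds hgood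
    (Eventually.of_forall fun _ => bot_le) ?_
  filter_upwards [eventually_lt_mul_sqrt (‖((sqrtEquiv hRC.posDef).symm :
    EuclideanSpace ℝ (Fin h) →L[ℝ] EuclideanSpace ℝ (Fin h))‖ * R') hδ, hRC.pooled_mle,
    eventually_gt_atTop 0] with n hnl hpool hn
  refine measure_mono_ae ?_
  filter_upwards [hpool] with ω hω hbad
  obtain ⟨hb1, hb2⟩ := hbad
  refine ⟨hb2, fun hg => ?_⟩
  have hsR : ∀ ℓ, ‖shifted r (stdEst est ψ J T n ω) ℓ‖ ≤ R' := norm_shifted_le hb2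
  have hs : √(n : ℝ) ≠ 0 := (Real.sqrt_pos.2 (by exact_mod_cast hn)).ne'
  set y := avgVec (shifted r (stdEst est ψ J T n ω)) with hy
  -- The comparison point whose standardized value is exactly the mean.
  set z := (ψ : EuclideanSpace ℝ (Fin h)) + (√(n : ℝ))⁻¹ • (sqrtEquiv hRC.posDef).symm y with hz
  have hzy : √(n : ℝ) • sqrtCLM J (z - ψ) = y := by
    rw [← sqrtEquiv_apply hRC.posDef, hz, add_sub_cancel_left, map_smul,
      ContinuousLinearEquiv.apply_symm_apply, smul_inv_smul₀ hs]
  have hzb : z ∈ Metric.ball (ψ : EuclideanSpace ℝ (Fin h)) δ := by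
    rw [Metric.mem_ball, dist_eq_norm]
    exact norm_sqrtEquiv_symm_lt hRC.posDef hn hnl (hzy ▸ norm_avgVec_le hm _ hsR)
  have key := abs_avgLoss_min_sub_le (p := (ψ : EuclideanSpace ℝ (Fin h))) hm (Nat.cast_nonneg n)
    (min_le_left _ _) hg.expansion (hg.mem_ball hm hω.1 hω.2 ψ.2)
    (fun z hz => loss_le_of_isMaxOn hω.2 (hball hz)) hzb
    (by rw [shifted_stdEst_eq hRC hn]; exact hzy)
  rw [shifted_stdEst_eq hRC hn] at key
  have hV : avgVar (shifted r (stdEst est ψ J T n ω)) ≤ R' ^ 2 := avgVar_le hm _ hsR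
  have h1 : η ≤ ε * R' ^ 2 := (hb1.trans key).trans (by gcongr)
  linarith

/-- The loss at the constrained maximizer is asymptotically the variance of the separate maximizers
plus the squared distance of their mean to the tangent space of the constraint. -/
theorem tendsto_loss_constrained (hm : 0 < m) (hRC : RegularityConditions est ψ J T r) {k : ℕ}
    {θ : EuclideanSpace ℝ (Fin h) → EuclideanSpace ℝ (Fin k)}
    {θ' : EuclideanSpace ℝ (Fin h) →L[ℝ] EuclideanSpace ℝ (Fin k)}
    (hθ : HasStrictFDerivAt θ θ' ψ) (hsurj : Function.Surjective θ')
    {ψ₀ : ∀ n, M.Obs n × (Fin m → M.Mis n) → EuclideanSpace ℝ (Fin h)}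
    (hψ₀ : IsConstrainedMLE ψ θ (θ ψ) ψ₀) {η : ℝ} (hη : 0 < η) :
    Tendsto (fun n => M.miLaw m n ψ {ω | η ≤
      |loss est n ω (ψ₀ n ω) - (avgVar (shifted r (stdEst est ψ J T n ω))
        + ‖(θ' ∘L ((sqrtEquiv hRC.posDef).symm :
            EuclideanSpace ℝ (Fin h) →L[ℝ] EuclideanSpace ℝ (Fin h))).kerᗮ.starProjection
          (avgVec (shifted r (stdEst est ψ J T n ω)))‖ ^ 2)|}) atTop (𝓝 0) := by
  set K := (θ' ∘L ((sqrtEquiv hRC.posDef).symm :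
    EuclideanSpace ℝ (Fin h) →L[ℝ] EuclideanSpace ℝ (Fin h))).ker with hK
  refine tendsto_measure_zero_of_tight (exists_forall_measure_norm_gt_le
    (stdEst_tendstoInDistribution hRC) measurable_stdEst) fun R => ?_
  set R' := (√(1 + r) + √r) * R with hR'
  set ε := min 1 (η / (80 * (R' ^ 2 + 1))) with hε
  have hε0 : 0 < ε := by positivity
  have hε1 : ε ≤ 1 := min_le_left _ _
  have hεη : 40 * ε * R' ^ 2 < η := by
    have : ε * (80 * (R' ^ 2 + 1)) ≤ η := (le_div_iff₀ (by positivity)).1 (min_le_right _ _)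
    nlinarith [sq_nonneg R']
  obtain ⟨δ₀, hδ₀, hθ1, hθ2⟩ := exists_level_close_tangent hθ hsurj (sqrtEquiv hRC.posDef) hε0
  obtain ⟨δ, hδ, hδδ₀, hball, hgood⟩ := tendsto_measure_not_isGood hRC hε0 hδ₀ R
  refine tendsto_of_tendsto_of_tendsto_of_le_of_le' tendsto_const_nhds hgood
    (Eventually.of_forall fun _ => bot_le) ?_
  -- The factor 2 in `2 * R'` is room for the comparison point `z` on the level set, whose
  -- standardized norm is at most `(1 + ε) ‖b‖`.
  filter_upwards [eventually_lt_mul_sqrt (‖((sqrtEquiv hRC.posDef).symm :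
    EuclideanSpace ℝ (Fin h) →L[ℝ] EuclideanSpace ℝ (Fin h))‖ * (2 * R')) hδ,
    eventually_lt_mul_sqrt R' hδ₀, hψ₀, eventually_gt_atTop 0] with n hnl hnl₀ hcon hn
  refine measure_mono_ae ?_
  filter_upwards [hcon] with ω hω hbad
  obtain ⟨hb1, hb2⟩ := hbad
  refine ⟨hb2, fun hg => ?_⟩
  have hsR : ∀ ℓ, ‖shifted r (stdEst est ψ J T n ω) ℓ‖ ≤ R' := norm_shifted_le hb2
  have hspos : 0 < √(n : ℝ) := Real.sqrt_pos.2 (by exact_mod_cast hn)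
  set y := avgVec (shifted r (stdEst est ψ J T n ω)) with hy
  have hyR : ‖y‖ ≤ R' := norm_avgVec_le hm _ hsR
  set b := K.starProjection y with hb
  have hbR : ‖b‖ ≤ R' := (K.norm_starProjection_apply_le y).trans hyR
  have hbK : (√(n : ℝ))⁻¹ • b ∈ K := K.smul_mem _ (K.starProjection_apply_mem y)
  have hbn : ‖(√(n : ℝ))⁻¹ • b‖ < δ₀ := by
    rw [norm_smul, norm_inv, Real.norm_of_nonneg hspos.le, inv_mul_lt_iff₀ hspos, mul_comm]
    exact hbR.trans_lt hnl₀
  -- The projected mean, scaled back by `√n`, is a small tangent vector; `z` is a point of the level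
  -- set near it.
  obtain ⟨z, hzθ, hzv⟩ := hθ2 _ hbK hbn
  have hzb' : ‖√(n : ℝ) • sqrtCLM J (z - ψ) - b‖ ≤ ε * ‖b‖ := by
    have h1 : √(n : ℝ) • sqrtCLM J (z - ψ) - b
        = √(n : ℝ) • (sqrtCLM J (z - ψ) - (√(n : ℝ))⁻¹ • b) := by
      rw [smul_sub, smul_inv_smul₀ hspos.ne']
    rw [sqrtEquiv_apply, norm_smul, norm_inv, Real.norm_of_nonneg hspos.le] at hzv
    rw [h1, norm_smul, Real.norm_of_nonneg hspos.le]
    calc √(n : ℝ) * _ ≤ √(n : ℝ) * (ε * ((√(n : ℝ))⁻¹ * ‖b‖)) := by gcongr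
      _ = ε * ‖b‖ := by field_simp
  have hzb : z ∈ Metric.ball (ψ : EuclideanSpace ℝ (Fin h)) δ := by
    rw [Metric.mem_ball, dist_eq_norm]
    refine norm_sqrtEquiv_symm_lt hRC.posDef hn hnl ?_
    have h1 : ‖√(n : ℝ) • sqrtCLM J (z - ψ)‖ ≤ ‖√(n : ℝ) • sqrtCLM J (z - ψ) - b‖ + ‖b‖ := by
      simpa using norm_add_le (√(n : ℝ) • sqrtCLM J (z - ψ) - b) b
    nlinarith [norm_nonneg b]
  have hx : ψ₀ n ω ∈ Metric.ball (ψ : EuclideanSpace ℝ (Fin h)) δ :=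
    hg.mem_ball hm hω.1.1 hω.2 ⟨ψ.2, rfl⟩
  have key := abs_avgLoss_constrained_min_sub_le (p := (ψ : EuclideanSpace ℝ (Fin h)))
    (K := K) (R := R') (C := {x | x ∈ M.Ψ ∧ θ x = θ ψ}) hm (Nat.cast_nonneg n) hε0.le hε1
    hg.expansion (fun ℓ => by rw [← shifted_stdEst hRC hn]; exact hsR ℓ)
    (fun x hxC hxb => hθ1 x (by
      rw [Metric.mem_ball, dist_eq_norm] at hxb; exact hxb.trans_le hδδ₀) hxC.2)
    hω.1 hx (fun z hzC _ => loss_le_of_isMaxOn hω.2 hzC) (z := z) ⟨hball hzb, hzθ⟩ hzb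
    (by
      rw [shifted_stdEst_eq hRC hn]
      exact hzb'.trans (by gcongr))
  rw [shifted_stdEst_eq hRC hn] at key
  have h1 : η ≤ 40 * ε * R' ^ 2 := hb1.trans key
  linarith

end MIModel

/-! ### The limits as functions of one Gaussian array -/

namespace MIModel

variable {h m : ℕ} {M : MIModel h} {est : M.Estimators m} {ψ : M.Ψ}
  {J : Matrix (Fin h) (Fin h) ℝ} {T : ℕ → Matrix (Fin h) (Fin h) ℝ} {r : ℝ}

theorem rM_pos (hr : 0 < r) : 0 < rM m r := by unfold rM; positivity

theorem continuous_avgVec_shifted :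
    Continuous fun w : PiLp 2 fun _ : Option (Fin m) => EuclideanSpace ℝ (Fin h) =>
      avgVec (shifted r w) := by
  unfold avgVec shifted; fun_prop

theorem continuous_avgVar_shifted :
    Continuous fun w : PiLp 2 fun _ : Option (Fin m) => EuclideanSpace ℝ (Fin h) =>
      avgVar (shifted r w) := by
  unfold avgVar avgVec shifted; fun_prop

theorem avgVec_shifted (hm : 0 < m)
    (w : PiLp 2 fun _ : Option (Fin m) => EuclideanSpace ℝ (Fin h)) :
    avgVec (shifted r w) = √(1 + r) • w none + √r • avgVec fun ℓ => w (some ℓ) := by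
  have hm' : (m : ℝ) ≠ 0 := by positivity
  simp only [avgVec, shifted, Finset.sum_add_distrib, Finset.sum_const, Finset.card_univ,
    Fintype.card_fin, ← Finset.smul_sum, smul_add]
  rw [← Nat.cast_smul_eq_nsmul ℝ, inv_smul_smul₀ hm', smul_comm]

/-- The common term `√(1 + r) w₀` cancels from the deviations, so the error of `ψ̂_obs` does not
enter. -/
theorem avgVar_shifted (hm : 0 < m) (hr : 0 < r)
    (w : PiLp 2 fun _ : Option (Fin m) => EuclideanSpace ℝ (Fin h)) :
    avgVar (shifted r w) = r * avgVar fun ℓ => w (some ℓ) := by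
  have h1 : ∀ ℓ, ‖shifted r w ℓ - avgVec (shifted r w)‖ ^ 2
      = r * ‖w (some ℓ) - avgVec fun ℓ => w (some ℓ)‖ ^ 2 := fun ℓ => by
    rw [avgVec_shifted hm, shifted, add_sub_add_left_eq_sub, ← smul_sub, norm_smul, mul_pow,
      Real.norm_eq_abs, sq_abs, Real.sq_sqrt hr.le]
  simp_rw [avgVar, h1, ← Finset.mul_sum]
  ring

/-- The weights of the standardized estimators in the standardized pooled estimator. -/
noncomputable def pooledWeight (m : ℕ) (r : ℝ) (i : Option (Fin m)) : ℝ :=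
  i.elim (√(1 + r) / √(1 + rM m r)) fun _ => √r / m / √(1 + rM m r)

/-- The mean has variance `1 + r + r / m` per coordinate, which is `1 + r_m`. -/
theorem sum_pooledWeight_sq (hm : 0 < m) (hr : 0 < r) : ∑ i, pooledWeight m r i ^ 2 = 1 := by
  have hm' : (0 : ℝ) < m := by exact_mod_cast hm
  have h1 : 0 < 1 + rM m r := by linarith [rM_pos (m := m) hr]
  simp only [Fintype.sum_option, pooledWeight, Option.elim, Finset.sum_const, Finset.card_univ,
    Fintype.card_fin, div_pow, Real.sq_sqrt h1.le, Real.sq_sqrt hr.le,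
    Real.sq_sqrt (by positivity : 0 ≤ 1 + r), nsmul_eq_mul]
  have h2 : 1 + rM m r = 1 + r + r / m := by unfold rM; field_simp; ring
  rw [h2] at h1 ⊢
  field_simp

theorem avgVec_shifted_eq_combine (hm : 0 < m) (hr : 0 < r)
    (w : PiLp 2 fun _ : Option (Fin m) => EuclideanSpace ℝ (Fin h)) :
    avgVec (shifted r w) = √(1 + rM m r) • combine (pooledWeight m r) w := by
  have h1 : √(1 + rM m r) ≠ 0 :=
    (Real.sqrt_pos.2 (by linarith [rM_pos (m := m) hr])).ne'
  rw [avgVec_shifted hm, combine_apply, Fintype.sum_option]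
  simp only [pooledWeight, Option.elim, ← Finset.smul_sum, smul_add, smul_smul]
  rw [mul_div_cancel₀ _ h1, mul_div_cancel₀ _ h1, avgVec, smul_smul, div_eq_mul_inv]

/-- The limit of the standardized `rRob`. -/
noncomputable def rRobLimit (r : ℝ)
    (w : PiLp 2 fun _ : Option (Fin m) => EuclideanSpace ℝ (Fin h)) : ℝ :=
  ((m : ℝ) + 1) / ((h : ℝ) * ((m : ℝ) - 1)) * avgVar (shifted r w) / rM m r

/-- The limit of the numerator of the likelihood ratio test, when `K` is the tangent space of the
constraint. -/
noncomputable def lrtLimit (K : Submodule ℝ (EuclideanSpace ℝ (Fin h))) (k : ℕ) (r : ℝ)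
    (w : PiLp 2 fun _ : Option (Fin m) => EuclideanSpace ℝ (Fin h)) : ℝ :=
  ‖Kᗮ.starProjection (avgVec (shifted r w))‖ ^ 2 / ((k : ℝ) * (1 + rM m r))

theorem continuous_rRobLimit : Continuous (rRobLimit (h := h) (m := m) r) :=
  (continuous_avgVar_shifted.const_mul _).div_const _

theorem continuous_lrtLimit (K : Submodule ℝ (EuclideanSpace ℝ (Fin h))) (k : ℕ) :
    Continuous (lrtLimit (m := m) K k r) :=
  ((Kᗮ.starProjection.continuous.comp continuous_avgVec_shifted).norm.pow 2).div_const _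

/-- Since `(m + 1) r / r_m = m`, the scaling turns the mean squared deviation into the sum of
squares, which is the squared length of a projection. -/
theorem rRobLimit_eq (hm : 1 < m) (hr : 0 < r)
    (w : PiLp 2 fun _ : Option (Fin m) => EuclideanSpace ℝ (Fin h)) :
    rRobLimit r w = ‖(centeredSubspace (EuclideanSpace ℝ (Fin h)) m).starProjection w‖ ^ 2
      / ((h * (m - 1) : ℕ) : ℝ) := by
  have hm' : (1 : ℝ) < m := by exact_mod_cast hm
  rw [norm_sq_centeredSubspace_starProjection (by lia), rRobLimit, avgVar_shifted (by lia) hr, rM,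
    Nat.cast_mul, Nat.cast_sub hm.le, Nat.cast_one]
  generalize avgVar (fun ℓ => w (some ℓ)) = V
  have h1 : (m : ℝ) - 1 ≠ 0 := by linarith
  have h2 : (m : ℝ) ≠ 0 := by linarith
  have h3 : (m : ℝ) + 1 ≠ 0 := by linarith
  -- For `h = 0` both sides are divisions by zero, with value `0`.
  rcases eq_or_ne (h : ℝ) 0 with h0 | h0
  · simp [h0]
  · field_simp

theorem lrtLimit_eq (hm : 0 < m) (hr : 0 < r) (K : Submodule ℝ (EuclideanSpace ℝ (Fin h)))
    (k : ℕ) (w : PiLp 2 fun _ : Option (Fin m) => EuclideanSpace ℝ (Fin h)) :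
    lrtLimit K k r w = ‖Kᗮ.starProjection (combine (pooledWeight m r) w)‖ ^ 2 / (k : ℝ) := by
  have h1 : 0 < 1 + rM m r := by linarith [rM_pos (m := m) hr]
  rw [lrtLimit, avgVec_shifted_eq_combine hm hr, map_smul, norm_smul, mul_pow, Real.norm_eq_abs,
    sq_abs, Real.sq_sqrt h1.le, mul_comm (k : ℝ), mul_div_mul_left _ _ h1.ne']

theorem hasLaw_rRobLimit (hm : 1 < m) (hr : 0 < r) :
    HasLaw (rRobLimit r) (chiSquaredOver (h * (m - 1)))
      (stdGaussian (PiLp 2 fun _ : Option (Fin m) => EuclideanSpace ℝ (Fin h))) := by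
  refine ⟨continuous_rRobLimit.measurable.aemeasurable, ?_⟩
  rw [funext (rRobLimit_eq hm hr)]
  exact map_stdGaussian_norm_sq_starProjection _
    (by rw [finrank_centeredSubspace (by lia), finrank_euclideanSpace_fin])

theorem hasLaw_lrtLimit (hm : 0 < m) (hr : 0 < r) {K : Submodule ℝ (EuclideanSpace ℝ (Fin h))}
    {k : ℕ} (hK : Module.finrank ℝ Kᗮ = k) :
    HasLaw (lrtLimit K k r) (chiSquaredOver k)
      (stdGaussian (PiLp 2 fun _ : Option (Fin m) => EuclideanSpace ℝ (Fin h))) := by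
  refine ⟨(continuous_lrtLimit K k).measurable.aemeasurable, ?_⟩
  have h1 := stdGaussian_map_of_adjoint_isometry (inner_combine (E := EuclideanSpace ℝ (Fin h))
    (pooledWeight m r)) (norm_toLp_smul (sum_pooledWeight_sq hm hr))
  rw [funext (lrtLimit_eq hm hr K k), ← map_stdGaussian_norm_sq_starProjection _ hK, ← h1,
    Measure.map_map (by fun_prop) (combine _).continuous.measurable]
  rfl

/-- One limit depends on the deviations from the mean only, the other on a combination that weighs
all imputations equally. -/
theorem indepFun_limits (hm : 1 < m) (hr : 0 < r) (K : Submodule ℝ (EuclideanSpace ℝ (Fin h)))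
    (k : ℕ) :
    IndepFun (rRobLimit r) (lrtLimit K k r)
      (stdGaussian (PiLp 2 fun _ : Option (Fin m) => EuclideanSpace ℝ (Fin h))) := by
  have h1 := indepFun_centeredSubspace_combine (E := EuclideanSpace ℝ (Fin h))
    (c := pooledWeight m r) (fun _ => rfl)
  rw [funext (rRobLimit_eq hm hr), funext (lrtLimit_eq (by lia) hr K k)]
  exact h1.comp (φ := fun x => ‖x‖ ^ 2 / ((h * (m - 1) : ℕ) : ℝ))
    (ψ := fun x => ‖Kᗮ.starProjection x‖ ^ 2 / (k : ℝ)) (by fun_prop) (by fun_prop)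

theorem measurable_avgLogLik (n : ℕ)
    {g : M.Obs n × (Fin m → M.Mis n) → Fin m → EuclideanSpace ℝ (Fin h)}
    (hg : ∀ ℓ, Measurable fun ω => g ω ℓ) : Measurable fun ω => M.avgLogLik ω (g ω) := by
  have hc : ∀ ℓ : Fin m, Measurable fun ω : M.Obs n × (Fin m → M.Mis n) => M.completed ω ℓ :=
    fun ℓ => measurable_fst.prodMk ((measurable_pi_apply ℓ).comp measurable_snd)
  exact (Finset.measurable_sum _ fun ℓ _ => Real.measurable_log.comp
    ((M.measurable_density n).comp ((hg ℓ).prodMk (hc ℓ)))).div_const _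

theorem measurable_rRob (n : ℕ) : Measurable (rRob est n) := by
  have hc : ∀ ℓ : Fin m, Measurable fun ω : M.Obs n × (Fin m → M.Mis n) => M.completed ω ℓ :=
    fun ℓ => measurable_fst.prodMk ((measurable_pi_apply ℓ).comp measurable_snd)
  exact (((measurable_avgLogLik n fun ℓ => (est.measurable_complete n).comp (hc ℓ)).const_mul
    2).sub ((measurable_avgLogLik n fun _ => est.measurable_pooled n).const_mul 2)).const_mul _

theorem measurable_lrtNumerator (k n : ℕ)
    {ψ₀ : ∀ n, M.Obs n × (Fin m → M.Mis n) → EuclideanSpace ℝ (Fin h)}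
    (hψ₀ : ∀ n, Measurable (ψ₀ n)) : Measurable (lrtNumerator est k r ψ₀ n) :=
  (((measurable_avgLogLik n fun _ => est.measurable_pooled n).sub
    (measurable_avgLogLik n fun _ => hψ₀ n)).const_mul 2).div_const _

theorem rRob_eq_loss (n : ℕ) (ω : M.Obs n × (Fin m → M.Mis n)) :
    rRob est n ω = ((m : ℝ) + 1) / ((h : ℝ) * ((m : ℝ) - 1)) * loss est n ω (est.pooled n ω) := by
  rw [loss_eq, rRob]

theorem lrtNumerator_eq_loss (k n : ℕ)
    (ψ₀ : ∀ n, M.Obs n × (Fin m → M.Mis n) → EuclideanSpace ℝ (Fin h))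
    (ω : M.Obs n × (Fin m → M.Mis n)) :
    lrtNumerator est k r ψ₀ n ω
      = (loss est n ω (ψ₀ n ω) - loss est n ω (est.pooled n ω)) / ((k : ℝ) * (1 + rM m r)) := by
  rw [loss_eq, loss_eq, lrtNumerator]
  ring

theorem tendsto_rRob (hm : 0 < m) (hRC : RegularityConditions est ψ J T r) :
    TendstoInDistribution (fun n ω => rRob est n ω / rM m r) atTop (rRobLimit r)
      (fun n => M.miLaw m n ψ)
      (stdGaussian (PiLp 2 fun _ : Option (Fin m) => EuclideanSpace ℝ (Fin h))) := by
  refine tendstoInDistribution_of_sub_tendsto_zero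
    ((stdEst_tendstoInDistribution hRC).continuous_comp continuous_rRobLimit)
    (fun n => continuous_rRobLimit.measurable.comp (measurable_stdEst n))
    (fun n => (measurable_rRob n).div_const _) fun η hη => ?_
  set c := ((m : ℝ) + 1) / ((h : ℝ) * ((m : ℝ) - 1)) / rM m r with hc
  have h1 := tendsto_loss_pooled hm hRC (show 0 < η / (|c| + 1) by positivity)
  refine tendsto_of_tendsto_of_tendsto_of_le_of_le tendsto_const_nhds h1 (fun _ => bot_le)
    fun n => measure_mono fun ω hω => ?_
  have heq : rRob est n ω / rM m r - rRobLimit r (stdEst est ψ J T n ω)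
      = c * (loss est n ω (est.pooled n ω) - avgVar (shifted r (stdEst est ψ J T n ω))) := by
    rw [rRob_eq_loss, rRobLimit, hc]; ring
  have h2 : η ≤ |c| * |loss est n ω (est.pooled n ω)
      - avgVar (shifted r (stdEst est ψ J T n ω))| := by
    rw [← abs_mul, ← heq]; exact hω
  refine (div_le_iff₀ (by positivity)).2 (h2.trans ?_)
  rw [mul_comm]
  gcongr
  linarith

/-- The numerator is a multiple of the constrained loss minus the pooled loss, so the variances
cancel and the squared distance to the tangent space remains. -/
theorem tendsto_rRob_lrtNumerator (hm : 0 < m) (hRC : RegularityConditions est ψ J T r) {k : ℕ}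
    {θ : EuclideanSpace ℝ (Fin h) → EuclideanSpace ℝ (Fin k)}
    {θ' : EuclideanSpace ℝ (Fin h) →L[ℝ] EuclideanSpace ℝ (Fin k)}
    (hθ : HasStrictFDerivAt θ θ' ψ) (hsurj : Function.Surjective θ')
    {ψ₀ : ∀ n, M.Obs n × (Fin m → M.Mis n) → EuclideanSpace ℝ (Fin h)}
    (hψ₀m : ∀ n, Measurable (ψ₀ n)) (hψ₀ : IsConstrainedMLE ψ θ (θ ψ) ψ₀) :
    TendstoInDistribution
      (fun n ω => (rRob est n ω / rM m r, lrtNumerator est k r ψ₀ n ω)) atTop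
      (fun w => (rRobLimit r w, lrtLimit (θ' ∘L ((sqrtEquiv hRC.posDef).symm :
        EuclideanSpace ℝ (Fin h) →L[ℝ] EuclideanSpace ℝ (Fin h))).ker k r w))
      (fun n => M.miLaw m n ψ)
      (stdGaussian (PiLp 2 fun _ : Option (Fin m) => EuclideanSpace ℝ (Fin h))) := by
  set K := (θ' ∘L ((sqrtEquiv hRC.posDef).symm :
    EuclideanSpace ℝ (Fin h) →L[ℝ] EuclideanSpace ℝ (Fin h))).ker with hK
  have hcont : Continuous fun w : PiLp 2 fun _ : Option (Fin m) => EuclideanSpace ℝ (Fin h) =>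
      (rRobLimit r w, lrtLimit K k r w) := continuous_rRobLimit.prodMk (continuous_lrtLimit K k)
  refine tendstoInDistribution_of_sub_tendsto_zero
    ((stdEst_tendstoInDistribution hRC).continuous_comp hcont)
    (fun n => hcont.measurable.comp (measurable_stdEst n))
    (fun n => ((measurable_rRob n).div_const _).prodMk (measurable_lrtNumerator k n hψ₀m))
    fun η hη => ?_
  set c := ((m : ℝ) + 1) / ((h : ℝ) * ((m : ℝ) - 1)) / rM m r with hc
  set d := ((k : ℝ) * (1 + rM m r))⁻¹ with hd
  -- The component errors are `c * x` and `d * (y - x)`; both are below `η` when `|x|` and `|y|` are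
  -- below `κ`.
  set κ := η / (|c| + 2 * |d| + 1) with hκ
  have hκ0 : 0 < κ := by positivity
  have hκη : κ * (|c| + 2 * |d| + 1) = η := div_mul_cancel₀ _ (by positivity)
  have h1 := tendsto_loss_pooled hm hRC hκ0
  have h2 := tendsto_loss_constrained hm hRC hθ hsurj hψ₀ hκ0
  refine tendsto_of_tendsto_of_tendsto_of_le_of_le tendsto_const_nhds (by simpa only [add_zero] using h1.add h2)
    (fun _ => bot_le) fun n => (measure_mono fun ω hω => ?_).trans (measure_union_le _ _)
  by_contra hcon
  obtain ⟨hx, hy⟩ := not_or.1 hcon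
  set x := loss est n ω (est.pooled n ω) - avgVar (shifted r (stdEst est ψ J T n ω)) with hxd
  set y := loss est n ω (ψ₀ n ω) - (avgVar (shifted r (stdEst est ψ J T n ω))
    + ‖Kᗮ.starProjection (avgVec (shifted r (stdEst est ψ J T n ω)))‖ ^ 2) with hyd
  replace hx : |x| < κ := not_le.1 hx
  replace hy : |y| < κ := not_le.1 hy
  have heq1 : rRob est n ω / rM m r - rRobLimit r (stdEst est ψ J T n ω) = c * x := by
    rw [rRob_eq_loss, rRobLimit, hc, hxd]; ring
  have heq2 : lrtNumerator est k r ψ₀ n ω - lrtLimit K k r (stdEst est ψ J T n ω)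
      = d * (y - x) := by
    rw [lrtNumerator_eq_loss, lrtLimit, hd, hyd, hxd]; ring
  have hω' : η ≤ max ‖c * x‖ ‖d * (y - x)‖ := by
    rw [← heq1, ← heq2]; exact hω
  have hc0 := abs_nonneg c
  have hd0 := abs_nonneg d
  rcases le_max_iff.1 hω' with h3 | h3
  · rw [Real.norm_eq_abs, abs_mul] at h3
    nlinarith
  · rw [Real.norm_eq_abs, abs_mul] at h3
    have h4 : |d| * |y - x| ≤ |d| * (2 * κ) := by
      gcongr; exact (abs_sub y x).trans (by linarith)
    nlinarith

end MIModel

/-! ### Degrees of freedom of the test and conclusion -/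

theorem finrank_orthogonal_ker {E F : Type*} [NormedAddCommGroup E] [InnerProductSpace ℝ E]
    [FiniteDimensional ℝ E] [NormedAddCommGroup F] [NormedSpace ℝ F] {A : E →L[ℝ] F}
    (hA : Function.Surjective A) : Module.finrank ℝ A.kerᗮ = Module.finrank ℝ F := by
  have h1 := LinearMap.finrank_range_add_finrank_ker (A : E →ₗ[ℝ] F)
  have h2 := A.ker.finrank_add_finrank_orthogonal
  rw [LinearMap.range_eq_top.2 hA, finrank_top] at h1
  exact add_left_cancel (h2.trans (h1.symm.trans (add_comm _ _)))

theorem mainTheorem3 {h k m : ℕ} (hh : 0 < h) (hk : 0 < k) (hm : 1 < m)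
    (M : MIModel h) (est : M.Estimators m) (ψ : M.Ψ)
    (J : Matrix (Fin h) (Fin h) ℝ) (T : ℕ → Matrix (Fin h) (Fin h) ℝ) (r : ℝ)
    (hRC : MIModel.RegularityConditions est ψ J T r)
    (θ : EuclideanSpace ℝ (Fin h) → EuclideanSpace ℝ (Fin k)) (θ₀ : EuclideanSpace ℝ (Fin k))
    (hθ : ContDiffOn ℝ 1 θ M.Ψ) (hθ_rank : Function.Surjective (fderiv ℝ θ ψ)) :
    ∃ (Ω : Type) (_ : MeasurableSpace Ω) (P : Measure Ω) (_ : IsProbabilityMeasure P)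
      (M₁ M₃ : Ω → ℝ),
      HasLaw M₁ (chiSquaredOver k) P ∧
      HasLaw M₃ (chiSquaredOver (h * (m - 1))) P ∧
      IndepFun M₃ M₁ P ∧
      TendstoInDistribution (fun n ω => MIModel.rRob est n ω / MIModel.rM m r) atTop M₃
        (fun n => M.miLaw m n ψ) P ∧
      (θ ψ = θ₀ →
        ∀ ψ₀ : ∀ n, M.Obs n × (Fin m → M.Mis n) → EuclideanSpace ℝ (Fin h),
          (∀ n, Measurable (ψ₀ n)) → MIModel.IsConstrainedMLE ψ θ θ₀ ψ₀ →
          TendstoInDistribution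
            (fun n ω => (MIModel.rRob est n ω / MIModel.rM m r,
              MIModel.lrtNumerator est k r ψ₀ n ω))
            atTop (fun ω => (M₃ ω, M₁ ω)) (fun n => M.miLaw m n ψ) P) := by
  have hr := hRC.r_pos
  have hm0 : 0 < m := by lia
  have hstrict : HasStrictFDerivAt θ (fderiv ℝ θ ψ) ψ :=
    (hθ.contDiffAt (M.isOpen_Ψ.mem_nhds ψ.2)).hasStrictFDerivAt one_ne_zero
  let A := fderiv ℝ θ ψ ∘L ((sqrtEquiv hRC.posDef).symm :
    EuclideanSpace ℝ (Fin h) →L[ℝ] EuclideanSpace ℝ (Fin h))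
  have hA : Function.Surjective A := hθ_rank.comp (sqrtEquiv hRC.posDef).symm.surjective
  -- Both limits live on the space of the Gaussian array. The tangent space at `ψ` defines `M₁`
  -- whether or not the null hypothesis holds.
  refine ⟨_, inferInstance, stdGaussian (PiLp 2 fun _ : Option (Fin m) => EuclideanSpace ℝ (Fin h)),
    inferInstance, MIModel.lrtLimit A.ker k r, MIModel.rRobLimit r,
    MIModel.hasLaw_lrtLimit hm0 hr ?_, MIModel.hasLaw_rRobLimit hm hr,
    MIModel.indepFun_limits hm hr _ _, MIModel.tendsto_rRob hm0 hRC, ?_⟩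
  · rw [finrank_orthogonal_ker hA, finrank_euclideanSpace_fin]
  · rintro rfl ψ₀ hψ₀m hψ₀
    exact MIModel.tendsto_rRob_lrtNumerator hm0 hRC hstrict hθ_rank hψ₀m hψ₀
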